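/- All graphs are finite and simple. For an integer $k\ge 1$, a graph $G$ is called $k$-critical if $G$ is not $(k-1)$-colorable, but every proper subgraph of $G$ is $(k-1)$-colorable. Let $d\ge 4$ be an integer and let $G'$ be a $(d+1)$-critical graph with maximum degree $\Delta(G')\le d+1$ in which the vertices of degree $d+1$ form an independent set. If $G'$ has $n$ vertices, of which $h>0$ have degree $d+1$, then $$h\ \ge\ \left\lceil\frac{(d-2)n-(d+1)(d-2)}{d}\right\rceil\qquad\text{and}\qquad h\ \le\ \left\lfloor\frac{n-3}{d-1}\right\rfloor .$$ -/

import Mathlib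

/-- A graph `G` is `k`-critical (`k ≥ 1`) if it is not `(k-1)`-colorable, but every proper subgraph
of `G` (obtained by deleting vertices and/or edges) is `(k-1)`-colorable. -/
structure SimpleGraph.IsCritical {V : Type*} (G : SimpleGraph V) (k : ℕ) : Prop where
  one_le : 1 ≤ k
  not_colorable : ¬ G.Colorable (k - 1)
  colorable_of_ne_top : ∀ H : G.Subgraph, H ≠ ⊤ → H.coe.Colorable (k - 1)

/-! The hypotheses leave almost no graphs: $G'$ is $K_{d+1}$, which has no vertex of degree $d+1$,
or $d=4$, $n=9$ and $h=2$, where both bounds equal $2$. This is `Tight.classification`, proved by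
induction on the number of vertices. Call vertices of degree $d$ low and those of degree $d+1$ high;
criticality excludes smaller degrees.

Split the $d$ colours into two palettes of sizes $r_0,r_1\ge 2$ and the vertices into two sides, so
that one side is colourable with its palette and the other becomes so after deleting one vertex (a
Mozhan-type partition). Among such states minimise $\sum_b (2e(V_b)-2r_b|V_b|)$. At a minimum, the
vertices whose deletion repairs the bad side form its core: a critical, $r$-regular union of
components (`Good.degIn_core`, `Good.crit`). Moving a low core vertex across preserves the minimum
and creates a core on the other side (`Good.flip`). A core always contains a low-low edge, since the
high vertices are independent and $r\ge 2$, so the walk can always leave by a low vertex other than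
the one it entered by. By finiteness it eventually moves a vertex next to the remains of an earlier
core (`Tight.exists_return_of_history`). Regularity then forces many adjacencies to coincide, which
yields $d+1$ vertices $N$, at least three of them low, with every low one adjacent to all others
(`Return.exists_twin_class`).

With at most one high vertex, $N$ is a clique and is everything. Otherwise colour the rest and count
free colours at the high vertices of $N$: two of them never share one, which leaves only $d=4$ with
two high vertices $u,w$ (`TwinClass.clique_or`). Merging $w$ into $u$ and deleting the rest of $N$
gives a smaller instance; by induction it is $K_5$, which recovers the nine-vertex graph, or
exceptional, which is impossible. -/

namespace HighIndep

open Finset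
open scoped Classical

noncomputable section

/-! ### Partial colourings and degrees inside finite vertex sets -/

section

variable {V : Type*} {G : SimpleGraph V}

/-- The subgraph of `G` induced by `S` has a proper colouring with `k` colours. -/
def Col (G : SimpleGraph V) (S : Finset V) (k : ℕ) : Prop :=
  ∃ c : V → ℕ, (∀ v ∈ S, c v < k) ∧ ∀ a ∈ S, ∀ b ∈ S, G.Adj a b → c a ≠ c b

/-- The number of neighbours of `v` in `S`. -/
def degIn (G : SimpleGraph V) (S : Finset V) (v : V) : ℕ := (S.filter (G.Adj v)).card

lemma Col.mono {S T : Finset V} {k l : ℕ} (h : Col G T k) (hST : S ⊆ T) (hkl : k ≤ l) :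
    Col G S l := by
  obtain ⟨c, h1, h2⟩ := h
  exact ⟨c, fun v hv => (h1 v (hST hv)).trans_le hkl,
    fun a ha b hb => h2 a (hST ha) b (hST hb)⟩

lemma Col.subset {S T : Finset V} {k : ℕ} (h : Col G T k) (hST : S ⊆ T) : Col G S k :=
  h.mono hST le_rfl

lemma Col.union {A B : Finset V} {a b : ℕ} (hA : Col G A a) (hB : Col G B b) :
    Col G (A ∪ B) (a + b) := by
  obtain ⟨c, h1, h2⟩ := hA
  obtain ⟨e, h3, h4⟩ := hB
  refine ⟨fun v => if v ∈ A then c v else a + e v, ?_, ?_⟩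
  · intro v hv
    by_cases hvA : v ∈ A
    · have := h1 v hvA
      simp only [hvA, if_true]; omega
    · have := h3 v ((mem_union.1 hv).resolve_left hvA)
      simp only [hvA, if_false]; omega
  · intro v hv w hw hvw
    by_cases hvA : v ∈ A <;> by_cases hwA : w ∈ A <;> simp only [hvA, hwA, if_true, if_false]
    · exact h2 v hvA w hwA hvw
    · have := h1 v hvA; omega
    · have := h1 w hwA; omega
    · have := h4 v ((mem_union.1 hv).resolve_left hvA) w ((mem_union.1 hw).resolve_left hwA) hvw
      omega

lemma Col.union_of_not_adj {S T : Finset V} {k : ℕ} (hS : Col G S k) (hT : Col G T k)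
    (hST : ∀ s ∈ S, ∀ t ∈ T, ¬ G.Adj s t) : Col G (S ∪ T) k := by
  obtain ⟨c, h1, h2⟩ := hS
  obtain ⟨e, h3, h4⟩ := hT
  refine ⟨fun v => if v ∈ S then c v else e v, ?_, ?_⟩
  · intro v hv
    by_cases hvA : v ∈ S
    · simpa only [hvA, if_true] using h1 v hvA
    · simpa only [hvA, if_false] using h3 v ((mem_union.1 hv).resolve_left hvA)
  · intro v hv w hw hvw
    by_cases hvA : v ∈ S <;> by_cases hwA : w ∈ S <;> simp only [hvA, hwA, if_true, if_false]
    · exact h2 v hvA w hwA hvw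
    · exact absurd hvw (hST v hvA w ((mem_union.1 hw).resolve_left hwA))
    · exact absurd hvw.symm (hST w hwA v ((mem_union.1 hv).resolve_left hvA))
    · exact h4 v ((mem_union.1 hv).resolve_left hvA) w ((mem_union.1 hw).resolve_left hwA) hvw

lemma exists_free_color (c : V → ℕ) (S : Finset V) (k : ℕ) (x : V) (h : degIn G S x < k) :
    ∃ i < k, ∀ v ∈ S, G.Adj x v → c v ≠ i := by
  have : ((S.filter (G.Adj x)).image c).card < (range k).card := by
    rw [card_range]
    exact card_image_le.trans_lt h
  obtain ⟨i, hi, hi'⟩ := exists_mem_notMem_of_card_lt_card this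
  refine ⟨i, mem_range.1 hi, fun v hv hxv hc => hi' ?_⟩
  exact mem_image.2 ⟨v, mem_filter.2 ⟨hv, hxv⟩, hc⟩

lemma Col.insert {S : Finset V} {k : ℕ} {x : V} (hS : Col G S k) (h : degIn G S x < k) :
    Col G (insert x S) k := by
  obtain ⟨c, h1, h2⟩ := hS
  obtain ⟨i, hi, hc⟩ := exists_free_color c S k x h
  refine ⟨Function.update c x i, ?_, ?_⟩
  · intro v hv
    by_cases hvx : v = x
    · subst hvx; simpa using hi
    · simpa [Function.update_of_ne hvx] using h1 v ((mem_insert.1 hv).resolve_left hvx)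
  · intro v hv w hw hvw
    by_cases hvx : v = x <;> by_cases hwx : w = x
    · subst hvx; subst hwx; exact absurd hvw (G.loopless.irrefl _)
    · subst hvx
      rw [Function.update_self, Function.update_of_ne hwx]
      exact (hc w ((mem_insert.1 hw).resolve_left hwx) hvw).symm
    · subst hwx
      rw [Function.update_self, Function.update_of_ne hvx]
      exact hc v ((mem_insert.1 hv).resolve_left hvx) hvw.symm
    · rw [Function.update_of_ne hwx, Function.update_of_ne hvx]
      exact h2 v ((mem_insert.1 hv).resolve_left hvx) w ((mem_insert.1 hw).resolve_left hwx) hvw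

/-- Colourings of two parts without edges between them can be glued at a common vertex. -/
lemma Col.glue {S T : Finset V} {k : ℕ} {x : V} (hS : Col G (Insert.insert x S) k)
    (hT : Col G (Insert.insert x T) k) (hST : ∀ s ∈ S, ∀ t ∈ T, ¬ G.Adj s t) :
    Col G (Insert.insert x (S ∪ T)) k := by
  obtain ⟨c, h1, h2⟩ := hS
  obtain ⟨e, h3, h4⟩ := hT
  have hcx := h1 x (mem_insert_self _ _)
  have hex := h3 x (mem_insert_self _ _)
  -- Permuting the colours of the second colouring makes the two agree at `x`.
  set p : Equiv.Perm ℕ := Equiv.swap (e x) (c x) with hp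
  have hpx : p (e x) = c x := Equiv.swap_apply_left _ _
  have hlt : ∀ m < k, p m < k := by
    intro m hm
    rw [hp, Equiv.swap_apply_def]
    split_ifs <;> assumption
  have key : ∀ v, v ∈ Insert.insert x (S ∪ T) → v ∉ Insert.insert x S → v ∈ T := by
    intro v hv hv'
    simp only [mem_insert, mem_union, not_or] at hv hv'
    tauto
  have mixed : ∀ v ∈ Insert.insert x S, ∀ w ∈ T, G.Adj v w → c v ≠ p (e w) := by
    intro v hv w hw hvw
    rcases mem_insert.1 hv with rfl | hv
    · rw [← hpx]
      exact fun h => h4 v (mem_insert_self _ _) w (mem_insert_of_mem hw) hvw (p.injective h)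
    · exact absurd hvw (hST v hv w hw)
  refine ⟨fun v => if v ∈ Insert.insert x S then c v else p (e v), ?_, ?_⟩
  · intro v hv
    by_cases hvA : v ∈ Insert.insert x S
    · simpa only [hvA, if_true] using h1 v hvA
    · simpa only [hvA, if_false] using hlt _ (h3 v (mem_insert_of_mem (key v hv hvA)))
  · intro v hv w hw hvw
    by_cases hvA : v ∈ Insert.insert x S <;> by_cases hwA : w ∈ Insert.insert x S <;>
      simp only [hvA, hwA, if_true, if_false]
    · exact h2 v hvA w hwA hvw
    · exact mixed v hvA w (key w hw hwA) hvw
    · exact (mixed w hwA v (key v hv hvA) hvw.symm).symm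
    · exact fun h => h4 v (mem_insert_of_mem (key v hv hvA)) w (mem_insert_of_mem (key w hw hwA))
        hvw (p.injective h)

lemma degIn_insert {S : Finset V} {x : V} (hx : x ∉ S) (v : V) :
    degIn G (insert x S) v = degIn G S v + if G.Adj v x then 1 else 0 := by
  unfold degIn
  rw [filter_insert]
  split_ifs with h
  · rw [card_insert_of_notMem (fun h => hx (mem_filter.1 h).1)]
  · simp

lemma degIn_erase {S : Finset V} {x : V} (hx : x ∈ S) (v : V) :
    degIn G S v = degIn G (S.erase x) v + if G.Adj v x then 1 else 0 := by
  conv_lhs => rw [← insert_erase hx]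
  exact degIn_insert (notMem_erase x S) v

lemma degIn_erase_self {S : Finset V} (x : V) : degIn G (S.erase x) x = degIn G S x := by
  by_cases hx : x ∈ S
  · rw [degIn_erase hx]; simp
  · rw [erase_eq_of_notMem hx]

lemma degIn_insert_self {S : Finset V} (x : V) : degIn G (insert x S) x = degIn G S x := by
  by_cases hx : x ∈ S
  · rw [insert_eq_of_mem hx]
  · rw [degIn_insert hx]; simp

lemma degIn_eq_of_closed {S T : Finset V} (h : S ⊆ T) {v : V}
    (hc : ∀ t ∈ T, G.Adj v t → t ∈ S) : degIn G S v = degIn G T v := by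
  unfold degIn
  congr 1
  ext t
  simp only [mem_filter]
  exact ⟨fun ⟨h1, h2⟩ => ⟨h h1, h2⟩, fun ⟨h1, h2⟩ => ⟨hc t h1 h2, h2⟩⟩

lemma degIn_union {S T : Finset V} (h : Disjoint S T) (v : V) :
    degIn G (S ∪ T) v = degIn G S v + degIn G T v := by
  unfold degIn
  rw [filter_union, card_union_of_disjoint (disjoint_filter_filter h)]

/-- If all neighbours of `v` in `T` are accounted for in `S`, they all lie in `S`. -/
lemma mem_of_degIn_le {S T : Finset V} (h : S ⊆ T) {v : V} (hd : degIn G T v ≤ degIn G S v)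
    {t : V} (ht : t ∈ T) (hvt : G.Adj v t) : t ∈ S := by
  have := eq_of_subset_of_card_le (filter_subset_filter (G.Adj v) h) hd
  have h2 : t ∈ S.filter (G.Adj v) := this ▸ mem_filter.2 ⟨ht, hvt⟩
  exact (mem_filter.1 h2).1

/-- The sum of the degrees in the subgraph induced by `S`. -/
def degSum (G : SimpleGraph V) (S : Finset V) : ℕ := ∑ v ∈ S, degIn G S v

lemma degSum_insert {S : Finset V} {x : V} (hx : x ∉ S) :
    degSum G (insert x S) = degSum G S + 2 * degIn G S x := by
  unfold degSum
  rw [sum_insert hx, degIn_insert_self, sum_congr rfl (fun v _ => degIn_insert hx v),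
    sum_add_distrib]
  have : (∑ v ∈ S, if G.Adj v x then 1 else 0) = degIn G S x := by
    rw [← card_filter]
    unfold degIn
    congr 1
    ext v
    simp [G.adj_comm]
  omega

lemma degSum_erase {S : Finset V} {x : V} (hx : x ∈ S) :
    degSum G S = degSum G (S.erase x) + 2 * degIn G S x := by
  conv_lhs => rw [← insert_erase hx]
  rw [degSum_insert (notMem_erase x S), degIn_erase_self]

end

/-! ### Critical sets, cores, and partitions of minimum weight -/

section

variable {V : Type*} {G : SimpleGraph V}

/-- `C` induces an `r`-regular subgraph that is vertex-critical for not being `r`-colourable. -/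
structure Crit (G : SimpleGraph V) (C : Finset V) (r : ℕ) : Prop where
  not_col : ¬ Col G C r
  erase_col : ∀ w ∈ C, Col G (C.erase w) r
  deg : ∀ w ∈ C, degIn G C w = r

/-- Deleting a vertex from a critical set leaves a connected graph. -/
lemma Crit.eq_erase_of_closed {C S : Finset V} {r : ℕ} (h : Crit G C r) {x : V} (hx : x ∈ C)
    (hS : S ⊆ C.erase x) (hne : S.Nonempty)
    (hcl : ∀ s ∈ S, ∀ t ∈ C.erase x, G.Adj s t → t ∈ S) : S = C.erase x := by
  by_contra hSC
  obtain ⟨t, ht, htS⟩ := exists_of_ssubset (hS.ssubset_of_ne hSC)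
  obtain ⟨s, hs⟩ := hne
  have hs' := mem_erase.1 (hS hs)
  have ht' := mem_erase.1 ht
  have h1 : Col G (insert x S) r := (h.erase_col t ht'.2).subset (by
    intro v hv
    rcases mem_insert.1 hv with rfl | hv
    · exact mem_erase.2 ⟨ht'.1.symm, hx⟩
    · exact mem_erase.2 ⟨fun h => htS (h ▸ hv), (mem_erase.1 (hS hv)).2⟩)
  have h2 : Col G (insert x (C.erase x \ S)) r := (h.erase_col s hs'.2).subset (by
    intro v hv
    rcases mem_insert.1 hv with rfl | hv
    · exact mem_erase.2 ⟨hs'.1.symm, hx⟩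
    · rw [mem_sdiff] at hv
      exact mem_erase.2 ⟨fun h => hv.2 (h ▸ hs), (mem_erase.1 hv.1).2⟩)
  -- A proper closed `S` would make `x` a cut vertex, and the two colourable pieces could be glued
  -- there.
  refine h.not_col ((Col.glue h1 h2 ?_).subset ?_)
  · intro a ha b hb hab
    rw [mem_sdiff] at hb
    exact hb.2 (hcl a ha b hb.1 hab)
  · intro v hv
    by_cases hvx : v = x
    · simp [hvx]
    · by_cases hvS : v ∈ S <;> simp [hvx, hvS, hv]

/-- Both sets are `r`-regular and share `Q`, so `q` needs the same number of neighbours outside `Q`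
in each. This is the source of all coincidences of neighbourhoods below. -/
lemma Crit.adj_iff {C D Q : Finset V} {r : ℕ} {x y : V} (hC : Crit G C r) (hD : Crit G D r)
    (hCQ : C = insert x Q) (hDQ : D = insert y Q) (hx : x ∉ Q) (hy : y ∉ Q) {q : V} (hq : q ∈ Q) :
    G.Adj q x ↔ G.Adj q y := by
  have h1 := hC.deg q (by simp [hCQ, hq])
  have h2 := hD.deg q (by simp [hDQ, hq])
  rw [hCQ, degIn_insert hx] at h1
  rw [hDQ, degIn_insert hy] at h2
  by_cases ha : G.Adj q x <;> by_cases hb : G.Adj q y <;> simp [ha, hb] at h1 h2 ⊢ <;> omega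

/-- The vertices of `A` whose deletion makes `A` colourable with `r` colours. -/
def core (G : SimpleGraph V) (A : Finset V) (r : ℕ) : Finset V :=
  A.filter fun y => Col G (A.erase y) r

lemma mem_core {A : Finset V} {r : ℕ} {y : V} :
    y ∈ core G A r ↔ y ∈ A ∧ Col G (A.erase y) r := mem_filter

lemma core_subset {A : Finset V} {r : ℕ} : core G A r ⊆ A := filter_subset _ _

/-- `Q` has no edges to the rest of `A`. -/
def Closed (G : SimpleGraph V) (A Q : Finset V) : Prop :=
  ∀ q ∈ Q, ∀ a ∈ A, G.Adj q a → a ∈ Q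

/-- If deleting a vertex of `Q` repaired `A`, then `A \ Q` would be colourable, and together with
the separate piece `Q` so would `A`. -/
lemma Closed.disjoint_core {A Q : Finset V} {r : ℕ} (hcl : Closed G A Q) (hA : ¬ Col G A r)
    (hQ : Col G Q r) : Disjoint Q (core G A r) := by
  rw [disjoint_left]
  intro w hwQ hw
  refine hA ((Col.union_of_not_adj hQ
    ((mem_core.1 hw).2.subset (?_ : A \ Q ⊆ A.erase w)) ?_).subset ?_)
  · intro v hv
    rw [mem_sdiff] at hv
    exact mem_erase.2 ⟨fun h => hv.2 (h ▸ hwQ), hv.1⟩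
  · intro s hs t ht hst
    rw [mem_sdiff] at ht
    exact ht.2 (hcl s hs t ht.1 hst)
  · intro v hv
    by_cases hvQ : v ∈ Q <;> simp [hvQ, hv]

/-- The missing vertex can be shifted along an edge: uncolour the neighbour `a` of `y`; then `y`
sees at most `r - 1` coloured vertices and can be coloured. -/
lemma closed_core {A : Finset V} {r : ℕ}
    (hreg : ∀ y ∈ core G A r, degIn G A y = r) : Closed G A (core G A r) := by
  intro y hy a ha hya
  have hy' := mem_core.1 hy
  have hne : y ≠ a := hya.ne
  have h1 : Col G ((A.erase a).erase y) r := hy'.2.subset (by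
    intro v hv; simp only [mem_erase] at hv ⊢; tauto)
  have h2 : degIn G ((A.erase a).erase y) y < r := by
    have := degIn_erase (G := G) ha y
    rw [degIn_erase_self, ← hreg y hy, this]
    simp [hya]
  have h3 := h1.insert h2
  rw [insert_erase (mem_erase.2 ⟨hne, hy'.1⟩)] at h3
  exact mem_core.2 ⟨ha, h3⟩

lemma crit_core {A : Finset V} {r : ℕ} (hA : ¬ Col G A r)
    (hne : (core G A r).Nonempty)
    (hreg : ∀ y ∈ core G A r, degIn G A y = r) : Crit G (core G A r) r := by
  have hcl := closed_core hreg
  refine ⟨fun h => ?_, fun w hw => (mem_core.1 hw).2.subset (erase_subset_erase _ core_subset),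
    fun w hw => ?_⟩
  · obtain ⟨y, hy⟩ := hne
    exact disjoint_left.1 (hcl.disjoint_core hA h) hy hy
  · rw [degIn_eq_of_closed core_subset (hcl w hw), hreg w hw]

/-- If a vertex `y` of the core is adjacent to what is left of a critical set after deleting `x`,
then it takes the place of `x` in it. -/
lemma core_eq_insert {A C : Finset V} {r : ℕ} {x y q : V} (hA : ¬ Col G A r)
    (hreg : ∀ y ∈ core G A r, degIn G A y = r) (hy : y ∈ core G A r) (hC : Crit G C r)
    (hx : x ∈ C) (hQA : C.erase x ⊆ A) (hyQ : y ∉ C.erase x)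
    (hcl : ∀ q ∈ C.erase x, ∀ a ∈ A, G.Adj q a → a ∈ C.erase x ∨ a = y)
    (hq : q ∈ C.erase x) (hqy : G.Adj q y) : core G A r = insert y (C.erase x) := by
  have hcc := closed_core hreg
  have hqc : q ∈ core G A r := hcc y hy q (hQA hq) hqy.symm
  have hsub : C.erase x ⊆ core G A r := by
    have := hC.eq_erase_of_closed (S := C.erase x ∩ core G A r) hx inter_subset_left
      ⟨q, mem_inter.2 ⟨hq, hqc⟩⟩ (by
        intro s hs t ht hst
        rw [mem_inter] at hs ⊢
        exact ⟨ht, hcc s hs.2 t (hQA ht) hst⟩)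
    exact inter_eq_left.1 this
  have hxQ : x ∉ C.erase x := notMem_erase x C
  -- In `C` and in the core, `p` has degree `r`; the only possible exchange is `x` against `y`.
  have hadj : ∀ p ∈ C.erase x, (G.Adj p x ↔ G.Adj p y) := by
    intro p hp
    have h1 := hC.deg p (mem_of_mem_erase hp)
    have h2 := hreg p (hsub hp)
    have h3 : degIn G (insert y (C.erase x)) p = degIn G A p := by
      refine degIn_eq_of_closed (insert_subset (mem_core.1 hy).1 hQA) fun t ht hpt => ?_
      rw [mem_insert]
      exact (hcl p hp t ht hpt).symm
    rw [← h3, degIn_insert hyQ] at h2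
    rw [degIn_erase hx] at h1
    by_cases ha : G.Adj p x <;> by_cases hb : G.Adj p y <;> simp [ha, hb] at h1 h2 ⊢ <;> omega
  have hdeg : degIn G (C.erase x) y = r := by
    rw [← hC.deg x hx, ← degIn_erase_self (S := C) x]
    unfold degIn
    congr 1
    ext p
    simp only [mem_filter]
    refine and_congr_right fun hp => ?_
    rw [G.adj_comm, ← hadj p hp, G.adj_comm]
  have hcl' : Closed G A (insert y (C.erase x)) := by
    intro p hp a ha hpa
    rcases mem_insert.1 hp with rfl | hp
    · exact mem_insert_of_mem (mem_of_degIn_le hQA (by rw [hdeg, hreg p hy]) ha hpa)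
    · rw [mem_insert]
      exact (hcl p hp a ha hpa).symm
  refine Subset.antisymm (fun w hw => ?_) (insert_subset hy hsub)
  by_contra hwD
  -- A core vertex `w` outside the closed set would make that set colourable, so it could not
  -- contain the core vertex `y`.
  have hcol : Col G (insert y (C.erase x)) r := (mem_core.1 hw).2.subset (by
    intro v hv
    refine mem_erase.2 ⟨fun h => hwD (h ▸ hv), ?_⟩
    exact (insert_subset (mem_core.1 hy).1 hQA) hv)
  exact disjoint_left.1 (hcl'.disjoint_core hA hcol) (mem_insert_self _ _) hy

/-- `U` induces a subgraph that is not `d`-colourable, is vertex-critical with this property, has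
maximum degree at most `d + 1`, and whose vertices of degree `d + 1` are independent. -/
structure Tight (d : ℕ) (G : SimpleGraph V) (U : Finset V) : Prop where
  not_col : ¬ Col G U d
  erase_col : ∀ v ∈ U, Col G (U.erase v) d
  deg_le : ∀ v ∈ U, degIn G U v ≤ d + 1
  indep : ∀ a ∈ U, ∀ b ∈ U, G.Adj a b → degIn G U a = d + 1 → degIn G U b ≠ d + 1

variable {d : ℕ} {U : Finset V}

lemma Tight.le_deg (h : Tight d G U) {v : V} (hv : v ∈ U) : d ≤ degIn G U v := by
  by_contra hlt
  have := (h.erase_col v hv).insert (x := v) (by rw [degIn_erase_self]; omega)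
  rw [insert_erase hv] at this
  exact h.not_col this

lemma Tight.deg_eq (h : Tight d G U) {v : V} (hv : v ∈ U) (hd : degIn G U v ≠ d) :
    degIn G U v = d + 1 := by
  have := h.le_deg hv
  have := h.deg_le v hv
  omega

lemma Tight.eq_of_not_col (h : Tight d G U) {Z : Finset V} (hZ : Z ⊆ U) (hc : ¬ Col G Z d) :
    Z = U := by
  by_contra hne
  obtain ⟨t, ht, htZ⟩ := exists_of_ssubset (hZ.ssubset_of_ne hne)
  exact hc ((h.erase_col t ht).subset fun v hv =>
    mem_erase.2 ⟨fun h => htZ (h ▸ hv), hZ hv⟩)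

/-- Without such an edge, low and high vertices of `C` would be the classes of a 2-colouring,
contradicting `2 ≤ r`. -/
lemma Tight.exists_low_edge (h : Tight d G U) {C : Finset V} {r : ℕ} (hr : 2 ≤ r) (hC : Crit G C r)
    (hCU : C ⊆ U) :
    ∃ a ∈ C, ∃ b ∈ C, degIn G U a = d ∧ degIn G U b = d ∧ G.Adj a b := by
  by_contra hno
  push Not at hno
  apply hC.not_col
  refine ⟨fun v => if degIn G U v = d then 0 else 1, ?_, ?_⟩
  · intro v _
    dsimp only
    split_ifs <;> omega
  · intro a ha b hb hab
    dsimp only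
    by_cases h1 : degIn G U a = d <;> by_cases h2 : degIn G U b = d <;> simp only [h1, h2, if_true, if_false]
    · exact absurd hab (hno a ha b hb h1 h2)
    · simp
    · simp
    · exact absurd (h.deg_eq (hCU hb) h2) (h.indep a (hCU ha) b (hCU hb) hab (h.deg_eq (hCU ha) h1))

/-- Every core vertex other than a prescribed one can be avoided when choosing a vertex of degree
`d` with a neighbour of degree `d`. -/
lemma Tight.exists_exit (h : Tight d G U) {C : Finset V} {r : ℕ} (hr : 2 ≤ r) (hC : Crit G C r)
    (hCU : C ⊆ U) (e : V) :
    ∃ x ∈ C, x ≠ e ∧ degIn G U x = d ∧ ∃ z ∈ C, degIn G U z = d ∧ G.Adj z x := by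
  obtain ⟨a, ha, b, hb, hda, hdb, hab⟩ := h.exists_low_edge hr hC hCU
  by_cases hae : a = e
  · exact ⟨b, hb, fun hbe => hab.ne (hae.trans hbe.symm), hdb, a, ha, hda, hab⟩
  · exact ⟨a, ha, hae, hda, b, hb, hdb, hab.symm⟩

/-- The vertices of `U` on side `b`. -/
def part (U : Finset V) (σ : V → Bool) (b : Bool) : Finset V := U.filter fun v => σ v = b

lemma mem_part {σ : V → Bool} {b : Bool} {v : V} : v ∈ part U σ b ↔ v ∈ U ∧ σ v = b := mem_filter

lemma part_subset {σ : V → Bool} {b : Bool} : part U σ b ⊆ U := filter_subset _ _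

lemma disjoint_part (σ : V → Bool) (b : Bool) : Disjoint (part U σ b) (part U σ (!b)) := by
  rw [disjoint_left]
  intro v h1 h2
  rw [mem_part] at h1 h2
  cases b <;> simp_all

lemma part_union (σ : V → Bool) (b : Bool) : part U σ b ∪ part U σ (!b) = U := by
  ext v
  simp only [mem_union, mem_part]
  cases b <;> cases σ v <;> simp

lemma degIn_part (σ : V → Bool) (b : Bool) (v : V) :
    degIn G (part U σ b) v + degIn G (part U σ (!b)) v = degIn G U v := by
  rw [← degIn_union (disjoint_part σ b), part_union]

/-- Move `x` to the other side. -/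
def flip (σ : V → Bool) (x : V) : V → Bool := Function.update σ x (!σ x)

lemma part_flip_same {σ : V → Bool} {x : V} {i : Bool} (hx : x ∈ part U σ i) :
    part U (flip σ x) i = (part U σ i).erase x := by
  ext v
  rw [mem_part] at hx
  by_cases hv : v = x
  · subst hv; simp [mem_part, flip, hx.2]
  · simp [mem_part, flip, hv]

lemma part_flip_other {σ : V → Bool} {x : V} {i : Bool} (hx : x ∈ part U σ i) :
    part U (flip σ x) (!i) = insert x (part U σ (!i)) := by
  ext v
  rw [mem_part] at hx
  by_cases hv : v = x
  · subst hv; simp [mem_part, flip, hx.2, hx.1]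
  · simp [mem_part, flip, hv]

/-- Side `!i` is colourable with `r (!i)` colours, and side `i` is colourable with `r i` colours
after the deletion of one vertex. -/
def IsState (G : SimpleGraph V) (U : Finset V) (r : Bool → ℕ) (σ : V → Bool) (i : Bool) : Prop :=
  (core G (part U σ i) (r i)).Nonempty ∧ Col G (part U σ (!i)) (r (!i))

/-- The potential minimised over all states. -/
def weight (G : SimpleGraph V) (U : Finset V) (r : Bool → ℕ) (σ : V → Bool) : ℤ :=
  (degSum G (part U σ true) - 2 * r true * (part U σ true).card) +
    (degSum G (part U σ false) - 2 * r false * (part U σ false).card)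

lemma weight_eq (r : Bool → ℕ) (σ : V → Bool) (i : Bool) : weight G U r σ =
    (degSum G (part U σ i) - 2 * r i * (part U σ i).card) +
    (degSum G (part U σ (!i)) - 2 * r (!i) * (part U σ (!i)).card) := by
  cases i
  · unfold weight; rw [add_comm]; rfl
  · rfl

lemma weight_flip (r : Bool → ℕ) {σ : V → Bool} {i : Bool} {x : V} (hx : x ∈ part U σ i) :
    weight G U r (flip σ x) = weight G U r σ
      - 2 * degIn G (part U σ i) x + 2 * r i + 2 * degIn G (part U σ (!i)) x - 2 * r (!i) := by
  have hx' : x ∉ part U σ (!i) := fun h => disjoint_left.1 (disjoint_part σ i) hx h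
  rw [weight_eq r σ i, weight_eq r (flip σ x) i, part_flip_same hx, part_flip_other hx,
    degSum_insert hx', card_insert_of_notMem hx', degSum_erase hx]
  have := card_erase_add_one hx
  rw [← this]
  push_cast
  ring

/-- A state of minimum weight. -/
structure Good (G : SimpleGraph V) (U : Finset V) (r : Bool → ℕ) (σ : V → Bool) (i : Bool) :
    Prop where
  state : IsState G U r σ i
  le : ∀ τ j, IsState G U r τ j → weight G U r σ ≤ weight G U r τ

variable {r : Bool → ℕ} {σ : V → Bool} {i : Bool}

lemma IsState.not_col (hs : IsState G U r σ i) (h : Tight d G U) (hsum : r i + r (!i) = d) :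
    ¬ Col G (part U σ i) (r i) := by
  intro hc
  have := hc.union hs.2
  rw [part_union, hsum] at this
  exact h.not_col this

lemma IsState.flip (hs : IsState G U r σ i) {x : V} (hx : x ∈ core G (part U σ i) (r i)) :
    IsState G U r (flip σ x) (!i) := by
  have hx' := mem_core.1 hx
  have hxn : x ∉ part U σ (!i) := fun h => disjoint_left.1 (disjoint_part σ i) hx'.1 h
  refine ⟨⟨x, mem_core.2 ?_⟩, ?_⟩
  · rw [part_flip_other hx'.1, erase_insert hxn]
    exact ⟨mem_insert_self _ _, hs.2⟩
  · rw [Bool.not_not, part_flip_same hx'.1]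
    exact hx'.2

lemma Good.le_degIn_other (hg : Good G U r σ i) (h : Tight d G U) (hsum : r i + r (!i) = d) {x : V}
    (hx : x ∈ core G (part U σ i) (r i)) : r (!i) ≤ degIn G (part U σ (!i)) x := by
  by_contra hlt
  have hx' := mem_core.1 hx
  have h1 := hx'.2.union (hg.state.2.insert (x := x) (by omega))
  refine h.not_col (hsum ▸ h1.subset fun v hv => ?_)
  rw [← part_union (U := U) σ i, mem_union] at hv
  by_cases hvx : v = x
  · simp [hvx]
  · rcases hv with hv | hv <;> simp [hvx, hv]

/-- A core vertex has at least `r b` neighbours on each side `b`, and at most `d + 1` in all. The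
one possible surplus neighbour is not on its own side, since moving the vertex would then lower the
weight. -/
lemma Good.degIn_core (hg : Good G U r σ i) (h : Tight d G U) (hsum : r i + r (!i) = d) :
    ∀ x ∈ core G (part U σ i) (r i), degIn G (part U σ i) x = r i := by
  intro x hx
  have hx' := mem_core.1 hx
  have h1 : r i ≤ degIn G (part U σ i) x := by
    by_contra hlt
    have := hx'.2.insert (x := x) (by rw [degIn_erase_self]; omega)
    rw [insert_erase hx'.1] at this
    exact hg.state.not_col h hsum this
  have h2 := hg.le_degIn_other h hsum hx
  have h3 := hg.le _ _ (hg.state.flip hx)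
  rw [weight_flip r hx'.1] at h3
  have h4 := degIn_part (G := G) (U := U) σ i x
  have h5 := h.deg_le x (part_subset hx'.1)
  omega

/-- A low core vertex has exactly `r b` neighbours on each side `b`, so moving it leaves the weight
unchanged. -/
lemma Good.flip (hg : Good G U r σ i) (h : Tight d G U) (hsum : r i + r (!i) = d) {x : V}
    (hx : x ∈ core G (part U σ i) (r i)) (hlow : degIn G U x = d) :
    Good G U r (flip σ x) (!i) := by
  refine ⟨hg.state.flip hx, fun τ j hτ => ?_⟩
  have hx' := mem_core.1 hx
  have h1 := hg.le τ j hτ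
  have h2 := hg.degIn_core h hsum x hx
  have h4 := degIn_part (G := G) (U := U) σ i x
  rw [weight_flip r hx'.1]
  omega

lemma Good.crit (hg : Good G U r σ i) (h : Tight d G U) (hsum : r i + r (!i) = d) :
    Crit G (core G (part U σ i) (r i)) (r i) :=
  crit_core (hg.state.not_col h hsum) hg.state.1 (hg.degIn_core h hsum)

lemma Good.closed (hg : Good G U r σ i) (h : Tight d G U) (hsum : r i + r (!i) = d) :
    Closed G (part U σ i) (core G (part U σ i) (r i)) :=
  closed_core (hg.degIn_core h hsum)

lemma mem_core_flip (hs : IsState G U r σ i) {x : V} (hx : x ∈ core G (part U σ i) (r i)) :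
    x ∈ core G (part U (HighIndep.flip σ x) (!i)) (r (!i)) := by
  have hx' := mem_core.1 hx
  have hxn : x ∉ part U σ (!i) := fun h => disjoint_left.1 (disjoint_part σ i) hx'.1 h
  refine mem_core.2 ?_
  rw [part_flip_other hx'.1, erase_insert hxn]
  exact ⟨mem_insert_self _ _, hs.2⟩

/-- Moving a core vertex `y` of degree `d` next to a closed leftover `C.erase x` of the other
side completes the leftover to the new core. -/
lemma Good.core_flip (hg : Good G U r σ i) (h : Tight d G U) (hsum : ∀ b, r b + r (!b) = d)
    {C : Finset V} {x y q : V} (hy : y ∈ core G (part U σ i) (r i))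
    (hlow : degIn G U y = d) (hC : Crit G C (r (!i))) (hx : x ∈ C)
    (hsub : C.erase x ⊆ part U σ (!i)) (hcl : Closed G (part U σ (!i)) (C.erase x))
    (hq : q ∈ C.erase x) (hqy : G.Adj q y) :
    core G (part U (HighIndep.flip σ y) (!i)) (r (!i)) = insert y (C.erase x) := by
  have hg' := hg.flip h (hsum i) hy hlow
  have hyp := (mem_core.1 hy).1
  have hpart := part_flip_other hyp
  refine core_eq_insert (hg'.state.not_col h (hsum _)) (hg'.degIn_core h (hsum _))
    (mem_core_flip hg.state hy) hC hx ?_ ?_ ?_ hq hqy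
  · rw [hpart]
    exact hsub.trans (subset_insert _ _)
  · exact fun hyC => disjoint_left.1 (disjoint_part σ i) hyp (hsub hyC)
  · intro p hp a ha hpa
    rw [hpart, mem_insert] at ha
    rcases ha with ha | ha
    · exact Or.inr ha
    · exact Or.inl (hcl p hp a ha hpa)

/-- A minimum state exists. -/
lemma Tight.exists_good [Finite V] (h : Tight d G U) (hsum : r true + r false = d) :
    ∃ σ i, Good G U r σ i := by
  have := Fintype.ofFinite V
  have hne : U.Nonempty := by
    rw [nonempty_iff_ne_empty]
    rintro rfl
    exact h.not_col ⟨fun _ => 0, by simp, by simp⟩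
  obtain ⟨x, hx⟩ := hne
  obtain ⟨c, hc1, hc2⟩ := h.erase_col x hx
  -- The first `r true` colour classes and the uncoloured vertex `x` form one side, the remaining
  -- classes the other.
  have hst : IsState G U r (fun v => decide (v = x ∨ c v < r true)) true := by
    refine ⟨⟨x, mem_core.2 ⟨mem_part.2 ⟨hx, by simp⟩, c, ?_, ?_⟩⟩, fun v => c v - r true, ?_, ?_⟩
    · intro v hv
      simp only [mem_erase, mem_part, decide_eq_true_eq] at hv
      tauto
    · intro a ha b hb hab
      simp only [mem_erase, mem_part] at ha hb
      exact hc2 a (mem_erase.2 ⟨ha.1, ha.2.1⟩) b (mem_erase.2 ⟨hb.1, hb.2.1⟩) hab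
    · intro v hv
      simp only [mem_part, Bool.not_true, decide_eq_false_iff_not, not_or, not_lt] at hv
      have := hc1 v (mem_erase.2 ⟨hv.2.1, hv.1⟩)
      simp only [Bool.not_true]
      omega
    · intro a ha b hb hab
      simp only [mem_part, Bool.not_true, decide_eq_false_iff_not, not_or, not_lt] at ha hb
      have := hc2 a (mem_erase.2 ⟨ha.2.1, ha.1⟩) b (mem_erase.2 ⟨hb.2.1, hb.1⟩) hab
      change c a - r true ≠ c b - r true
      omega
  obtain ⟨⟨σ, i⟩, hmem, hmin⟩ := exists_min_image
    (univ.filter fun p : (V → Bool) × Bool => IsState G U r p.1 p.2)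
    (fun p => weight G U r p.1) ⟨(_, true), mem_filter.2 ⟨mem_univ _, hst⟩⟩
  exact ⟨σ, i, (mem_filter.1 hmem).2, fun τ j hτ => hmin (τ, j) (mem_filter.2 ⟨mem_univ _, hτ⟩)⟩

end

/-! ### Returns and the twin class they force -/

section

variable {V : Type*} {G : SimpleGraph V} {d : ℕ} {U : Finset V} {r : Bool → ℕ} {σ : V → Bool}
  {i : Bool} {C₀ C₁ : Finset V} {x₀ x₁ y z t : V}

/-- The situation in which a sequence of moves returns to the remainder of an earlier core `C₀`:
the moved vertex `y` replaces `x₀` in `C₀`, while the remainder of the core `C₁` that was created by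
moving `x₀`, and was left through `x₁`, is still a component of the other side. -/
structure Return (d : ℕ) (G : SimpleGraph V) (U : Finset V) (r : Bool → ℕ) (σ : V → Bool) (i : Bool)
    (C₀ : Finset V) (x₀ : V) (C₁ : Finset V) (x₁ y : V) : Prop where
  good : Good G U r σ i
  core_eq : core G (part U σ i) (r i) = insert y (C₀.erase x₀)
  y_notMem : y ∉ C₀.erase x₀
  y_low : degIn G U y = d
  crit₀ : Crit G C₀ (r i)
  mem₀ : x₀ ∈ C₀
  low₀ : degIn G U x₀ = d
  crit₁ : Crit G C₁ (r (!i))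
  mem₀₁ : x₀ ∈ C₁
  mem₁ : x₁ ∈ C₁
  ne : x₁ ≠ x₀
  sub₁ : C₁ ⊆ U
  side₁ : C₁.erase x₁ ⊆ part U σ (!i)
  closed₁ : Closed G (part U σ (!i)) (C₁.erase x₁)
  disj : Disjoint (C₀.erase x₀) C₁

/-- What a return tells about a neighbour `z` of `x₀` in `C₀`. -/
structure Twins (G : SimpleGraph V) (C₀ : Finset V) (x₀ : V) (C₁ : Finset V) (x₁ z : V) : Prop where
  adj : G.Adj x₀ x₁
  first : ∀ q ∈ C₀.erase x₀, (G.Adj q x₁ ↔ G.Adj q x₀)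
  second : ∀ q ∈ C₁.erase x₁, (G.Adj q z ↔ G.Adj q x₁)
  twin : ∀ q ∈ C₀.erase x₀, q ≠ z → (G.Adj q z ↔ G.Adj q x₀)

/-- Moving `z` next to `x₀` completes `C₁.erase x₁`; moving `x₀` back then completes the old core
without `z`. Comparing successive cores by `Crit.adj_iff` gives the adjacencies. The position after
the first move is again a return with the roles of the sides exchanged, so the lemma can be applied
once more. -/
lemma Return.twins (hR : Return d G U r σ i C₀ x₀ C₁ x₁ y) (h : Tight d G U)
    (hsum : ∀ b, r b + r (!b) = d) (hr : ∀ b, 2 ≤ r b) (hz : z ∈ C₀) (hzx : G.Adj z x₀)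
    (hzlow : degIn G U z = d) :
    y = x₁ ∧ Twins G C₀ x₀ C₁ x₁ z ∧
      Return d G U r (flip σ z) (!i) C₁ x₁ (insert x₁ (C₀.erase x₀)) z z := by
  have hzQ : z ∈ C₀.erase x₀ := mem_erase.2 ⟨hzx.ne, hz⟩
  have hyQ := hR.y_notMem
  have hD := hR.good.crit h (hsum i)
  have hDcl := hR.good.closed h (hsum i)
  have hzD : z ∈ core G (part U σ i) (r i) := by rw [hR.core_eq]; exact mem_insert_of_mem hzQ
  have hyD : y ∈ core G (part U σ i) (r i) := by rw [hR.core_eq]; exact mem_insert_self _ _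
  have hQD : C₀.erase x₀ ⊆ core G (part U σ i) (r i) := by rw [hR.core_eq]; exact subset_insert _ _
  have hx₀R : x₀ ∈ C₁.erase x₁ := mem_erase.2 ⟨hR.ne.symm, hR.mem₀₁⟩
  have hzi := (mem_core.1 hzD).1
  have hyi := (mem_core.1 hyD).1
  have hadj0 : ∀ q ∈ C₀.erase x₀, (G.Adj q y ↔ G.Adj q x₀) := fun q hq =>
    hD.adj_iff hR.crit₀ hR.core_eq (insert_erase hR.mem₀).symm hyQ (notMem_erase _ _) hq
  have hzR : z ∉ C₁.erase x₁ := fun hm => disjoint_left.1 (disjoint_part σ i) hzi (hR.side₁ hm)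
  -- move `z`
  have hg1 := hR.good.flip h (hsum i) hzD hzlow
  have hc1 := hR.good.core_flip h hsum hzD hzlow hR.crit₁ hR.mem₁ hR.side₁ hR.closed₁ hx₀R hzx.symm
  have hE := hg1.crit h (hsum _)
  have hadj1 : ∀ q ∈ C₁.erase x₁, (G.Adj q z ↔ G.Adj q x₁) := fun q hq =>
    hE.adj_iff hR.crit₁ hc1 (insert_erase hR.mem₁).symm hzR (notMem_erase _ _) hq
  have hx01 : G.Adj x₀ x₁ := (hadj1 x₀ hx₀R).1 hzx.symm
  have hp1 : part U (flip σ z) (!!i) = (part U σ i).erase z := by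
    rw [Bool.not_not, part_flip_same hzi]
  have hside2 : (core G (part U σ i) (r i)).erase z ⊆ part U (flip σ z) (!!i) := by
    rw [hp1]; exact erase_subset_erase _ core_subset
  have hcl2 : Closed G (part U (flip σ z) (!!i)) ((core G (part U σ i) (r i)).erase z) := by
    rw [hp1]
    intro q hq a ha hqa
    rw [mem_erase] at ha
    exact mem_erase.2 ⟨ha.1, hDcl q (mem_of_mem_erase hq) a ha.2 hqa⟩
  -- move `x₀` back
  have hx₀E : x₀ ∈ core G (part U (flip σ z) (!i)) (r (!i)) := by
    rw [hc1]; exact mem_insert_of_mem hx₀R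
  -- Since `2 ≤ r i`, `x₀` has a second neighbour in `C₀`, which attaches it to what remains after
  -- `z` has left.
  obtain ⟨w, hwQ, hwx, hwz⟩ : ∃ w ∈ C₀.erase x₀, G.Adj w x₀ ∧ w ≠ z := by
    have h1 := hR.crit₀.deg x₀ hR.mem₀
    have h2 : 1 < (C₀.filter (G.Adj x₀)).card := by
      have := hr i; unfold degIn at h1; omega
    obtain ⟨w, hw, hwz⟩ := exists_mem_ne h2 z
    rw [mem_filter] at hw
    exact ⟨w, mem_erase.2 ⟨hw.2.ne', hw.1⟩, hw.2.symm, hwz⟩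
  have hg2 := hg1.flip h (hsum _) hx₀E hR.low₀
  have hc2 := hg1.core_flip h hsum hx₀E hR.low₀ (by simpa using hD) hzD hside2 hcl2
    (mem_erase.2 ⟨hwz, hQD hwQ⟩) hwx
  have hx₀D : x₀ ∉ (core G (part U σ i) (r i)).erase z := by
    rw [hR.core_eq]
    intro hm
    rcases mem_insert.1 (mem_of_mem_erase hm) with hm | hm
    · exact disjoint_left.1 (disjoint_part σ i) hyi (hR.side₁ (hm ▸ hx₀R))
    · exact notMem_erase _ _ hm
  have hF := hg2.crit h (hsum _)
  have hadj2 : ∀ q ∈ (core G (part U σ i) (r i)).erase z, (G.Adj q z ↔ G.Adj q x₀) := fun q hq =>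
    (by simpa using hD : Crit G (core G (part U σ i) (r i)) (r (!!i))).adj_iff hF
      (insert_erase hzD).symm hc2 (notMem_erase _ _) hx₀D hq
  have hyz : y ≠ z := fun hyz => hyQ (hyz ▸ hzQ)
  have hyx₀ : G.Adj y x₀ :=
    (hadj2 y (mem_erase.2 ⟨hyz, hyD⟩)).1 ((hadj0 z hzQ).2 hzx).symm
  -- The `d` neighbours of the low vertex `x₀` all lie in `C₀` or `C₁`, so its neighbour `y` lies in
  -- `C₁`; only `x₁` is not confined to the opposite side.
  have hyx₁ : y = x₁ := by
    have hdisj : Disjoint (C₀.erase x₀) (C₁.erase x₀) :=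
      hR.disj.mono_right (erase_subset _ _)
    have hdeg : degIn G (C₀.erase x₀ ∪ C₁.erase x₀) x₀ = d := by
      rw [degIn_union hdisj, degIn_erase_self, degIn_erase_self, hR.crit₀.deg _ hR.mem₀,
        hR.crit₁.deg _ hR.mem₀₁, hsum]
    have hsub : C₀.erase x₀ ∪ C₁.erase x₀ ⊆ U :=
      union_subset (hQD.trans (core_subset.trans part_subset)) ((erase_subset _ _).trans hR.sub₁)
    have := mem_of_degIn_le hsub (by rw [hdeg, hR.low₀]) (part_subset hyi) hyx₀.symm
    have hyC₁ : y ∈ C₁ := mem_of_mem_erase ((mem_union.1 this).resolve_left hyQ)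
    by_contra hne
    exact disjoint_left.1 (disjoint_part σ i) hyi (hR.side₁ (mem_erase.2 ⟨hne, hyC₁⟩))
  subst hyx₁
  refine ⟨rfl, ⟨hx01, hadj0, hadj1, fun q hq hqz => hadj2 q (mem_erase.2 ⟨hqz, hQD hq⟩)⟩, ?_⟩
  rw [← hR.core_eq]
  exact
    { good := hg1
      core_eq := hc1
      y_notMem := hzR
      y_low := hzlow
      crit₀ := hR.crit₁
      mem₀ := hR.mem₁
      low₀ := hR.y_low
      crit₁ := by simpa using hD
      mem₀₁ := hyD
      mem₁ := hzD
      ne := hyz.symm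
      sub₁ := core_subset.trans part_subset
      side₁ := hside2
      closed₁ := hcl2
      disj := ((disjoint_part σ i).mono_left core_subset).symm.mono_left hR.side₁ }

/-- A return produces a vertex `x₀` such that all vertices of degree `d` in its closed neighbourhood
have the same closed neighbourhood. -/
lemma Return.exists_twin_class (hR : Return d G U r σ i C₀ x₀ C₁ x₁ y) (h : Tight d G U)
    (hsum : ∀ b, r b + r (!b) = d) (hr : ∀ b, 2 ≤ r b)
    (hz : ∃ z ∈ C₀, degIn G U z = d ∧ G.Adj z x₀) :
    ∃ N ⊆ U, N.card = d + 1 ∧ 3 ≤ (N.filter fun v => degIn G U v = d).card ∧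
      ∀ t ∈ N, degIn G U t = d → ∀ s ∈ N, s ≠ t → G.Adj s t := by
  obtain ⟨z, hz, hzlow, hzx⟩ := hz
  obtain ⟨rfl, hT, hR'⟩ := hR.twins h hsum hr hz hzx hzlow
  have hx₀U : x₀ ∈ U := hR.sub₁ hR.mem₀₁
  have hx₀R : x₀ ∈ C₁.erase y := mem_erase.2 ⟨hR.ne.symm, hR.mem₀₁⟩
  have hzQ : z ∈ C₀.erase x₀ := mem_erase.2 ⟨hzx.ne, hz⟩
  have hzy : z ≠ y := fun hzy => hR.y_notMem (hzy ▸ hzQ)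
  -- The exchanged return gives the same information about every low neighbour of `y` in `C₁`.
  have hsecond : ∀ t ∈ C₁, degIn G U t = d → G.Adj t y →
      Twins G C₁ y (insert y (C₀.erase x₀)) z t := fun t ht htlow hty =>
    (hR'.twins h hsum hr ht hty htlow).2.1
  have hT0 := hsecond x₀ hR.mem₀₁ hR.low₀ hT.adj
  have hQU : C₀.erase x₀ ⊆ U := by
    have : insert y (C₀.erase x₀) ⊆ U := by
      rw [← hR.core_eq]; exact core_subset.trans part_subset
    exact (subset_insert _ _).trans this
  have hcover : ∀ s ∈ U, G.Adj x₀ s → s ∈ C₀.erase x₀ ∪ C₁.erase x₀ := by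
    intro s hs hxs
    have hdeg : degIn G (C₀.erase x₀ ∪ C₁.erase x₀) x₀ = d := by
      rw [degIn_union (hR.disj.mono_right (erase_subset _ _)), degIn_erase_self, degIn_erase_self,
        hR.crit₀.deg _ hR.mem₀, hR.crit₁.deg _ hR.mem₀₁, hsum]
    exact mem_of_degIn_le (union_subset hQU ((erase_subset _ _).trans hR.sub₁))
      (by rw [hdeg, hR.low₀]) hs hxs
  -- The closed neighbourhood of `x₀` is the class; `x₀`, `y` and `z` are its three low vertices.
  set N := insert x₀ (U.filter (G.Adj x₀)) with hN
  have hx₀N : x₀ ∉ U.filter (G.Adj x₀) := by simp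
  have hmem : ∀ s ∈ N, s = x₀ ∨ s = y ∨ (s ∈ C₀.erase x₀ ∧ G.Adj s x₀) ∨
      (s ∈ C₁.erase y ∧ s ≠ x₀ ∧ G.Adj s x₀ ∧ G.Adj s y) := by
    intro s hs
    rcases mem_insert.1 hs with hs | hs
    · exact Or.inl hs
    · rw [mem_filter] at hs
      by_cases hsy : s = y
      · exact Or.inr (Or.inl hsy)
      · rcases mem_union.1 (hcover s hs.1 hs.2) with hsQ | hsR
        · exact Or.inr (Or.inr (Or.inl ⟨hsQ, hs.2.symm⟩))
        · have hsR' : s ∈ C₁.erase y := mem_erase.2 ⟨hsy, mem_of_mem_erase hsR⟩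
          exact Or.inr (Or.inr (Or.inr ⟨hsR', hs.2.ne', hs.2.symm,
            (hT0.twin s hsR' hs.2.ne').1 hs.2.symm⟩))
  have hyU : y ∈ U := hR.sub₁ hR.mem₁
  refine ⟨N, insert_subset hx₀U (filter_subset _ _), ?_, ?_, ?_⟩
  · rw [hN, card_insert_of_notMem hx₀N]
    exact congrArg (· + 1) hR.low₀
  · have hsub : ({x₀, y, z} : Finset V) ⊆ N.filter fun v => degIn G U v = d := by
      intro v hv
      simp only [mem_insert, mem_singleton] at hv
      rw [mem_filter]
      rcases hv with rfl | rfl | rfl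
      · exact ⟨mem_insert_self _ _, hR.low₀⟩
      · exact ⟨mem_insert_of_mem (mem_filter.2 ⟨hyU, hT.adj⟩), hR.y_low⟩
      · exact ⟨mem_insert_of_mem (mem_filter.2 ⟨hQU hzQ, hzx.symm⟩), hzlow⟩
    refine le_trans (le_of_eq ?_) (card_le_card hsub)
    rw [card_insert_of_notMem, card_insert_of_notMem, card_singleton]
    · simpa using hzy.symm
    · simp only [mem_insert, mem_singleton, not_or]
      exact ⟨hR.ne.symm, hzx.ne'⟩
  · -- it remains to compare the members of `N` pairwise, up to symmetry
    have hQQ : ∀ p ∈ C₀.erase x₀, G.Adj p x₀ → degIn G U p = d → ∀ q ∈ C₀.erase x₀, G.Adj q x₀ →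
        q ≠ p → G.Adj q p := by
      intro p hp hpx hplow q hq hqx hqp
      exact ((hR.twins h hsum hr (mem_of_mem_erase hp) hpx hplow).2.1.twin q hq hqp).2 hqx
    have hQR : ∀ p ∈ C₀.erase x₀, G.Adj p x₀ → degIn G U p = d → ∀ q ∈ C₁.erase y,
        G.Adj q y → G.Adj q p := by
      intro p hp hpx hplow q hq hqy
      exact ((hR.twins h hsum hr (mem_of_mem_erase hp) hpx hplow).2.1.second q hq).2 hqy
    intro t ht htlow s hs hst
    rcases hmem t ht with rfl | rfl | ⟨htQ, htx⟩ | ⟨htR, htne, htx, hty⟩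
    · rcases mem_insert.1 hs with hs | hs
      · exact absurd hs hst
      · exact (mem_filter.1 hs).2.symm
    · rcases hmem s hs with rfl | rfl | ⟨hsQ, hsx⟩ | ⟨hsR, hsne, hsx, hsy⟩
      · exact hT.adj
      · exact absurd rfl hst
      · exact (hT.first s hsQ).2 hsx
      · exact hsy
    · rcases hmem s hs with rfl | rfl | ⟨hsQ, hsx⟩ | ⟨hsR, hsne, hsx, hsy⟩
      · exact htx.symm
      · exact ((hT.first t htQ).2 htx).symm
      · exact hQQ t htQ htx htlow s hsQ hsx hst
      · exact hQR t htQ htx htlow s hsR hsy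
    · have hTt := hsecond t (mem_of_mem_erase htR) htlow hty
      rcases hmem s hs with rfl | rfl | ⟨hsQ, hsx⟩ | ⟨hsR, hsne, hsx, hsy⟩
      · exact htx.symm
      · exact hty.symm
      · by_cases hsz : s = z
        · subst hsz
          exact ((hT.second t htR).2 hty).symm
        · exact (hTt.second s (mem_erase.2 ⟨hsz, mem_insert_of_mem hsQ⟩)).2
            ((hT.twin s hsQ hsz).2 hsx)
      · exact (hTt.twin s hsR hst).2 hsy

end

/-! ### The walk through cores ends in a return -/

section

variable {V : Type*} {G : SimpleGraph V} {d : ℕ} {U : Finset V} {r : Bool → ℕ} {σ : V → Bool}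
  {i : Bool}

/-- A former core `C` on side `b`, left through the vertex `x` of degree `d`, whose remaining
vertices still form a component of side `b`. -/
structure Leftover (d : ℕ) (G : SimpleGraph V) (U : Finset V) (r : Bool → ℕ) (σ : V → Bool)
    (C : Finset V) (x : V) (b : Bool) : Prop where
  crit : Crit G C (r b)
  mem : x ∈ C
  low : degIn G U x = d
  exit : ∃ z ∈ C, degIn G U z = d ∧ G.Adj z x
  sub : C ⊆ U
  side : C.erase x ⊆ part U σ b
  closed : Closed G (part U σ b) (C.erase x)

/-- The core `C'`, left through `x'`, arose by moving `x` out of `C`. -/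
structure Link (C : Finset V) (x : V) (b : Bool) (C' : Finset V) (x' : V) (b' : Bool) : Prop where
  mem : x ∈ C'
  ne : x' ≠ x
  disj : Disjoint (C.erase x) C'
  side : b' = !b

lemma Leftover.disjoint_core {C : Finset V} {x : V} (hL : Leftover d G U r σ C x i)
    (hg : Good G U r σ i) (h : Tight d G U) (hsum : ∀ b, r b + r (!b) = d) :
    Disjoint (C.erase x) (core G (part U σ i) (r i)) :=
  hL.closed.disjoint_core (hg.state.not_col h (hsum i)) (hL.crit.erase_col x hL.mem)

lemma Leftover.flip_same {C : Finset V} {x v : V} (hL : Leftover d G U r σ C x i)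
    (hg : Good G U r σ i) (h : Tight d G U) (hsum : ∀ b, r b + r (!b) = d)
    (hv : v ∈ core G (part U σ i) (r i)) : Leftover d G U r (flip σ v) C x i := by
  have hvC : v ∉ C.erase x := fun hm => disjoint_left.1 (hL.disjoint_core hg h hsum) hm hv
  have hp := part_flip_same (mem_core.1 hv).1
  refine ⟨hL.crit, hL.mem, hL.low, hL.exit, hL.sub, ?_, ?_⟩
  · rw [hp]
    exact fun w hw => mem_erase.2 ⟨fun hwv => hvC (hwv ▸ hw), hL.side hw⟩
  · rw [hp]
    exact fun q hq a ha => hL.closed q hq a (mem_of_mem_erase ha)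

lemma Leftover.flip_other {C : Finset V} {x v : V} (hL : Leftover d G U r σ C x (!i))
    (hv : v ∈ core G (part U σ i) (r i)) (hadj : ∀ q ∈ C.erase x, ¬ G.Adj q v) :
    Leftover d G U r (flip σ v) C x (!i) := by
  have hp := part_flip_other (mem_core.1 hv).1
  refine ⟨hL.crit, hL.mem, hL.low, hL.exit, hL.sub, ?_, ?_⟩
  · rw [hp]
    exact hL.side.trans (subset_insert _ _)
  · rw [hp]
    intro q hq a ha hqa
    rcases mem_insert.1 ha with rfl | ha
    · exact absurd hqa (hadj q hq)
    · exact hL.closed q hq a ha hqa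

lemma Good.leftover (hg : Good G U r σ i) (h : Tight d G U) (hsum : ∀ b, r b + r (!b) = d) {x : V}
    (hx : x ∈ core G (part U σ i) (r i)) (hlow : degIn G U x = d)
    (hexit : ∃ z ∈ core G (part U σ i) (r i), degIn G U z = d ∧ G.Adj z x) :
    Leftover d G U r (HighIndep.flip σ x) (core G (part U σ i) (r i)) x i := by
  have hp := part_flip_same (mem_core.1 hx).1
  refine ⟨hg.crit h (hsum i), hx, hlow, hexit, core_subset.trans part_subset, ?_, ?_⟩
  · rw [hp]
    exact erase_subset_erase _ core_subset
  · rw [hp]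
    intro q hq a ha hqa
    rw [mem_erase] at ha
    exact mem_erase.2 ⟨ha.1, hg.closed h (hsum i) q (mem_of_mem_erase hq) a ha.2 hqa⟩

/-- `L` records the cores left so far, all of whose remainders are still components of their sides,
and `W` the vertices visited. Leave the current core by a low vertex other than the entry `x`. If it
lands next to a recorded remainder, this is a return; otherwise all remainders survive and the new
core contains an unvisited vertex, so `m` bounds the length of the walk. -/
lemma Tight.exists_return_of_history (h : Tight d G U) (hsum : ∀ b, r b + r (!b) = d)
    (hr : ∀ b, 2 ≤ r b) (m : ℕ) :
    ∀ (σ : V → Bool) (i : Bool) (C : Finset V) (x : V) (L : Set (Finset V × V × Bool))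
      (W : Finset V), Good G U r σ i → (C, x, !i) ∈ L →
      (∀ l ∈ L, Leftover d G U r σ l.1 l.2.1 l.2.2) →
      (∀ l ∈ L, l = (C, x, !i) ∨ ∃ l' ∈ L, Link l.1 l.2.1 l.2.2 l'.1 l'.2.1 l'.2.2) →
      x ∈ core G (part U σ i) (r i) → W ⊆ U →
      (∀ v ∈ W, v ∈ core G (part U σ i) (r i) ∨ ∃ l ∈ L, v ∈ l.1.erase l.2.1) →
      U.card - W.card < m →
      ∃ σ i C₀ x₀ C₁ x₁ y, Return d G U r σ i C₀ x₀ C₁ x₁ y ∧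
        ∃ z ∈ C₀, degIn G U z = d ∧ G.Adj z x₀ := by
  induction m with
  | zero => intros; omega
  | succ m ih =>
    intro σ i C x L W hg hCL hleft hlink hx hWU hW hm
    have hcrit := hg.crit h (hsum i)
    have hDU : core G (part U σ i) (r i) ⊆ U := core_subset.trans part_subset
    obtain ⟨v, hv, hvx, hvlow, hvexit⟩ := h.exists_exit (hr i) hcrit hDU x
    have hvp := (mem_core.1 hv).1
    have hg' := hg.flip h (hsum i) hv hvlow
    have hnew := hg.leftover h hsum hv hvlow hvexit
    have hvcore := mem_core_flip hg.state hv
    set D := core G (part U σ i) (r i) with hD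
    -- Only the most recent record lacks a successor; the core being left now becomes it.
    have hlink' : ∀ l ∈ L, ∃ l' ∈ insert (D, v, i) L,
        Link l.1 l.2.1 l.2.2 l'.1 l'.2.1 l'.2.2 := by
      intro l hl
      rcases hlink l hl with rfl | ⟨l', hl', hll'⟩
      · refine ⟨_, Set.mem_insert _ _, hx, hvx, ?_, by simp⟩
        exact ((disjoint_part σ i).mono_left core_subset).symm.mono_left (hleft _ hl).side
      · exact ⟨l', Set.mem_insert_of_mem _ hl', hll'⟩
    have hsame : ∀ l ∈ insert (D, v, i) L, l.2.2 = i →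
        Leftover d G U r (HighIndep.flip σ v) l.1 l.2.1 i := by
      rintro l (rfl | hl) hli
      · exact hnew
      · exact (hli ▸ hleft l hl).flip_same hg h hsum hv
    by_cases hret : ∃ l ∈ L, l.2.2 = !i ∧ ∃ q ∈ l.1.erase l.2.1, G.Adj q v
    · obtain ⟨l, hl, hli, q, hq, hqv⟩ := hret
      obtain ⟨l', hl', hll⟩ := hlink' l hl
      have hl2 : Leftover d G U r σ l.1 l.2.1 (!i) := hli ▸ hleft l hl
      have hl'i : l'.2.2 = i := by rw [hll.side, hli, Bool.not_not]
      have hl'2 := hsame l' hl' hl'i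
      have hmem' : l'.2.1 ∈ l'.1 := hl'2.mem
      refine ⟨HighIndep.flip σ v, !i, l.1, l.2.1, l'.1, l'.2.1, v, ?_, hl2.exit⟩
      exact
        { good := hg'
          core_eq := hg.core_flip h hsum hv hvlow hl2.crit hl2.mem hl2.side hl2.closed hq hqv
          y_notMem := fun hm => disjoint_left.1 (disjoint_part σ i) hvp (hl2.side hm)
          y_low := hvlow
          crit₀ := hl2.crit
          mem₀ := hl2.mem
          low₀ := hl2.low
          crit₁ := by simpa using hl'2.crit
          mem₀₁ := hll.mem
          mem₁ := hmem'
          ne := hll.ne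
          sub₁ := hl'2.sub
          side₁ := by simpa using hl'2.side
          closed₁ := by simpa using hl'2.closed
          disj := hll.disj }
    · push Not at hret
      have hleft' : ∀ l ∈ insert (D, v, i) L,
          Leftover d G U r (HighIndep.flip σ v) l.1 l.2.1 l.2.2 := by
        intro l hl
        by_cases hli : l.2.2 = i
        · have := hsame l hl hli
          rwa [← hli] at this
        · have hli' : l.2.2 = !i := Bool.eq_not.2 hli
          rcases hl with rfl | hl
          · exact absurd rfl hli
          · have hl2 : Leftover d G U r σ l.1 l.2.1 (!i) := hli' ▸ hleft l hl
            rw [hli']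
            exact hl2.flip_other hv (hret l hl hli')
      have hsub' : core G (part U (HighIndep.flip σ v) (!i)) (r (!i)) ⊆ U :=
        core_subset.trans part_subset
      refine ih (HighIndep.flip σ v) (!i) D v (insert (D, v, i) L)
        (W ∪ core G (part U (HighIndep.flip σ v) (!i)) (r (!i))) hg' (by simp) hleft' ?_ hvcore
        (union_subset hWU hsub') ?_ ?_
      · rintro l (rfl | hl)
        · left; simp
        · exact Or.inr (hlink' l hl)
      · intro w hw
        rcases mem_union.1 hw with hw | hw
        · rcases hW w hw with hw | ⟨l, hl, hwl⟩
          · by_cases hwv : w = v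
            · exact Or.inl (hwv ▸ hvcore)
            · exact Or.inr ⟨_, Set.mem_insert _ _, mem_erase.2 ⟨hwv, hw⟩⟩
          · exact Or.inr ⟨l, Set.mem_insert_of_mem _ hl, hwl⟩
        · exact Or.inl hw
      · -- the new core has a vertex that was not visited before
        obtain ⟨w, hw, hwv⟩ : ∃ w ∈ core G (part U (HighIndep.flip σ v) (!i)) (r (!i)), w ≠ v := by
          have hc := (hg'.crit h (hsum _)).deg v hvcore
          have hpos : 0 < degIn G (core G (part U (HighIndep.flip σ v) (!i)) (r (!i))) v := by
            have := hr (!i); omega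
          obtain ⟨w, hw⟩ := card_pos.1 hpos
          rw [mem_filter] at hw
          exact ⟨w, hw.1, hw.2.ne'⟩
        -- Visited vertices lie in the core just left or in a remainder: those on side `i` are on
        -- the wrong side, and remainders on side `!i` miss the new core.
        have hwW : w ∉ W := by
          intro hwW
          have hwp : w ∈ part U σ (!i) := by
            have := core_subset hw
            rw [part_flip_other hvp] at this
            exact (mem_insert.1 this).resolve_left hwv
          rcases hW w hwW with hwD | ⟨l, hl, hwl⟩
          · exact disjoint_left.1 (disjoint_part σ i) (core_subset hwD) hwp
          · have hl' := hleft' l (Set.mem_insert_of_mem _ hl)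
            by_cases hli : l.2.2 = i
            · have h2 := (hleft l hl).side hwl
              rw [hli] at h2
              exact disjoint_left.1 (disjoint_part σ i) h2 hwp
            · have hli' : l.2.2 = !i := Bool.eq_not.2 hli
              rw [hli'] at hl'
              exact disjoint_left.1 (hl'.disjoint_core hg' h hsum) hwl hw
        have h1 : W.card < (W ∪ core G (part U (HighIndep.flip σ v) (!i)) (r (!i))).card :=
          card_lt_card ⟨subset_union_left, fun hsub => hwW (hsub (mem_union_right _ hw))⟩
        have h2 := card_le_card (union_subset hWU hsub')
        omega

lemma Tight.exists_return [Finite V] (h : Tight d G U) (hsum : ∀ b, r b + r (!b) = d)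
    (hr : ∀ b, 2 ≤ r b) :
    ∃ σ i C₀ x₀ C₁ x₁ y, Return d G U r σ i C₀ x₀ C₁ x₁ y ∧
      ∃ z ∈ C₀, degIn G U z = d ∧ G.Adj z x₀ := by
  obtain ⟨σ, i, hg⟩ := h.exists_good (hsum true)
  obtain ⟨e, he⟩ := hg.state.1
  obtain ⟨v, hv, -, hvlow, hvexit⟩ :=
    h.exists_exit (hr i) (hg.crit h (hsum i)) (core_subset.trans part_subset) e
  have hnew := hg.leftover h hsum hv hvlow hvexit
  refine h.exists_return_of_history hsum hr (U.card + 1) (flip σ v) (!i)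
    (core G (part U σ i) (r i)) v {(core G (part U σ i) (r i), v, i)} ∅ (hg.flip h (hsum i) hv hvlow) (by simp) ?_ ?_
    (mem_core_flip hg.state hv) (empty_subset _) (by simp) (by simp)
  · rintro l rfl
    exact hnew
  · rintro l rfl
    left; simp

/-- The palettes have `2` and `d - 2` colours; `4 ≤ d` makes both at least `2`. -/
lemma Tight.exists_twin_class [Finite V] (h : Tight d G U) (hd : 4 ≤ d) :
    ∃ N ⊆ U, N.card = d + 1 ∧ 3 ≤ (N.filter fun v => degIn G U v = d).card ∧
      ∀ t ∈ N, degIn G U t = d → ∀ s ∈ N, s ≠ t → G.Adj s t := by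
  have hsum : ∀ b, (fun b : Bool => if b then 2 else d - 2) b +
      (fun b : Bool => if b then 2 else d - 2) (!b) = d := by
    intro b; cases b <;> simp <;> omega
  have hr : ∀ b, 2 ≤ (fun b : Bool => if b then 2 else d - 2) b := by
    intro b; cases b <;> simp; omega
  obtain ⟨σ, i, C₀, x₀, C₁, x₁, y, hR, hz⟩ := h.exists_return hsum hr
  exact hR.exists_twin_class h hsum hr hz

end

/-! ### Colouring around a twin class -/

section

variable {V : Type*} {G : SimpleGraph V} {d : ℕ} {U N : Finset V}

lemma not_col_of_clique {S : Finset V} {k : ℕ} (h : ∀ s ∈ S, ∀ t ∈ S, s ≠ t → G.Adj s t)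
    (hk : k < S.card) : ¬ Col G S k := by
  rintro ⟨c, h1, h2⟩
  obtain ⟨a, ha, b, hb, hab, hc⟩ := exists_ne_map_eq_of_card_lt_of_maps_to
    (by simpa using hk : (range k).card < S.card) (fun v hv => mem_range.2 (h1 v hv))
  exact h2 a ha b hb (h a ha b hb hab) hc

lemma exists_critical_subset {S : Finset V} {k : ℕ} (h : ¬ Col G S k) :
    ∃ T ⊆ S, ¬ Col G T k ∧ ∀ v ∈ T, Col G (T.erase v) k := by
  induction S using Finset.strongInduction with
  | H S ih =>
    by_cases hS : ∀ v ∈ S, Col G (S.erase v) k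
    · exact ⟨S, Subset.rfl, h, hS⟩
    · push Not at hS
      obtain ⟨v, hv, hc⟩ := hS
      obtain ⟨T, hT, h1, h2⟩ := ih _ (erase_ssubset hv) hc
      exact ⟨T, hT.trans (erase_subset _ _), h1, h2⟩

lemma exists_injOn_of_card_le {K : Finset V} {S : Finset ℕ} (h : K.card ≤ S.card) :
    ∃ g : V → ℕ, (∀ v ∈ K, g v ∈ S) ∧ Set.InjOn g K := by
  obtain ⟨T, hT, hc⟩ := exists_subset_card_eq h
  let e := equivOfCardEq hc.symm
  refine ⟨fun v => if h : v ∈ K then (e ⟨v, h⟩ : ℕ) else 0, ?_, ?_⟩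
  · intro v hv
    simp only [hv, dif_pos]
    exact hT (e ⟨v, hv⟩).2
  · intro v hv w hw hvw
    have hv' : v ∈ K := hv
    have hw' : w ∈ K := hw
    simp only [hv', hw', dif_pos] at hvw
    simpa using e.injective (Subtype.ext hvw)

/-- `N` has `d + 1` vertices, and those of degree `d` are adjacent to all others. -/
structure TwinClass (d : ℕ) (G : SimpleGraph V) (U N : Finset V) : Prop where
  sub : N ⊆ U
  card : N.card = d + 1
  adj : ∀ t ∈ N, degIn G U t = d → ∀ s ∈ N, s ≠ t → G.Adj s t

/-- The vertices of degree `d` in `N`. -/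
def lows (d : ℕ) (G : SimpleGraph V) (U N : Finset V) : Finset V :=
  N.filter fun v => degIn G U v = d

/-- The vertices of `N` whose degree is not `d`. -/
def highs (d : ℕ) (G : SimpleGraph V) (U N : Finset V) : Finset V :=
  N.filter fun v => degIn G U v ≠ d

lemma mem_lows {v : V} : v ∈ lows d G U N ↔ v ∈ N ∧ degIn G U v = d := mem_filter

lemma mem_highs {v : V} : v ∈ highs d G U N ↔ v ∈ N ∧ degIn G U v ≠ d := mem_filter

lemma TwinClass.card_add (hN : TwinClass d G U N) :
    (lows d G U N).card + (highs d G U N).card = d + 1 := by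
  rw [← hN.card]
  exact card_filter_add_card_filter_not _

lemma TwinClass.closed (hN : TwinClass d G U N) {t x : V} (ht : t ∈ lows d G U N) (hx : x ∈ U)
    (htx : G.Adj t x) : x ∈ N := by
  rw [mem_lows] at ht
  refine mem_of_degIn_le hN.sub ?_ hx htx
  rw [ht.2]
  have : N.erase t ⊆ N.filter (G.Adj t) := by
    intro s hs
    rw [mem_erase] at hs
    exact mem_filter.2 ⟨hs.2, (hN.adj t ht.1 ht.2 s hs.2 hs.1).symm⟩
  have h2 := card_le_card this
  rw [card_erase_of_mem ht.1, hN.card] at h2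
  exact h2

lemma TwinClass.not_adj_highs (hN : TwinClass d G U N) (h : Tight d G U) {u w : V}
    (hu : u ∈ highs d G U N) (hw : w ∈ highs d G U N) : ¬ G.Adj u w := by
  rw [mem_highs] at hu hw
  exact fun huw => h.indep u (hN.sub hu.1) w (hN.sub hw.1) huw (h.deg_eq (hN.sub hu.1) hu.2)
    (h.deg_eq (hN.sub hw.1) hw.2)

/-- Inside `N`, a high vertex sees exactly the low ones, which number `d + 1` minus the number of
high ones. -/
lemma TwinClass.degIn_sdiff (hN : TwinClass d G U N) (h : Tight d G U) {u : V}
    (hu : u ∈ highs d G U N) : degIn G (U \ N) u = (highs d G U N).card := by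
  have hu' := mem_highs.1 hu
  have h1 : degIn G U u = degIn G N u + degIn G (U \ N) u := by
    rw [← degIn_union disjoint_sdiff, union_sdiff_of_subset hN.sub]
  have h2 : degIn G N u = (lows d G U N).card := by
    unfold degIn
    congr 1
    ext v
    rw [mem_filter, mem_lows]
    constructor
    · rintro ⟨hv, huv⟩
      refine ⟨hv, ?_⟩
      by_contra hne
      exact hN.not_adj_highs h hu (mem_highs.2 ⟨hv, hne⟩) huv
    · rintro ⟨hv, hlow⟩
      exact ⟨hv, hN.adj v hv hlow u hu'.1 fun huv => hu'.2 (huv ▸ hlow)⟩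
  have h3 := h.deg_eq (hN.sub hu'.1) hu'.2
  have h4 := hN.card_add
  omega

/-- In a colouring of the rest, two vertices of degree `d + 1` of `N` have no common free colour. -/
lemma TwinClass.not_free (hN : TwinClass d G U N) (h : Tight d G U)
    (hk : 2 ≤ (lows d G U N).card) {c : V → ℕ} (hc : ∀ v ∈ U \ N, c v < d)
    (hc' : ∀ a ∈ U \ N, ∀ b ∈ U \ N, G.Adj a b → c a ≠ c b) {u w : V} (hu : u ∈ highs d G U N)
    (hw : w ∈ highs d G U N) (huw : u ≠ w) {a : ℕ} (ha : a < d)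
    (hau : ∀ x ∈ U \ N, G.Adj u x → c x ≠ a) (haw : ∀ x ∈ U \ N, G.Adj w x → c x ≠ a) : False := by
  have hKJ := hN.card_add
  have hJdeg : ∀ v ∈ highs d G U N, degIn G (U \ N) v < d := by
    intro v hv
    rw [hN.degIn_sdiff h hv]
    omega
  set J := highs d G U N with hJ
  set K := lows d G U N with hK
  have hfree : ∀ v, ∃ b, v ∈ J → b < d ∧ ∀ x ∈ U \ N, G.Adj v x → c x ≠ b := by
    intro v
    by_cases hv : v ∈ J
    · obtain ⟨b, hb, hb'⟩ := exists_free_color c (U \ N) d v (hJdeg v hv)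
      exact ⟨b, fun _ => ⟨hb, hb'⟩⟩
    · exact ⟨0, fun hv' => absurd hv' hv⟩
  choose f hf using hfree
  -- Sharing `a` saves one colour on the high vertices, leaving enough for the low ones to be
  -- coloured injectively.
  set e : V → ℕ := fun v => if v = u ∨ v = w then a else f v with he
  have hej : ∀ v ∈ J, e v < d ∧ ∀ x ∈ U \ N, G.Adj v x → c x ≠ e v := by
    intro v hv
    by_cases h1 : v = u ∨ v = w
    · simp only [he, h1, if_true]
      rcases h1 with rfl | rfl
      · exact ⟨ha, hau⟩
      · exact ⟨ha, haw⟩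
    · simp only [he, h1, if_false]
      exact hf v hv
  have himg : (J.image e).card ≤ J.card - 1 := by
    have h1 : J.image e ⊆ (J.erase u).image e := by
      intro m hm
      obtain ⟨v, hv, rfl⟩ := mem_image.1 hm
      by_cases hvu : v = u
      · exact mem_image.2 ⟨w, mem_erase.2 ⟨huw.symm, hw⟩, by simp [he, hvu]⟩
      · exact mem_image_of_mem _ (mem_erase.2 ⟨hvu, hv⟩)
    exact (card_le_card h1).trans (card_image_le.trans (card_erase_of_mem hu).le)
  have hJpos : 0 < J.card := card_pos.2 ⟨u, hu⟩
  obtain ⟨g, hg, hginj⟩ : ∃ g : V → ℕ, (∀ v ∈ K, g v ∈ range d \ J.image e) ∧ Set.InjOn g K := by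
    apply exists_injOn_of_card_le
    have := le_card_sdiff (J.image e) (range d)
    rw [card_range] at this
    omega
  have hJK : ∀ v ∈ J, v ∉ K := fun v hv hv' => (mem_highs.1 hv).2 (mem_lows.1 hv').2
  obtain ⟨p, hp⟩ : ∃ p : V → ℕ, p = fun v => if v ∈ K then g v else if v ∈ J then e v else c v :=
    ⟨_, rfl⟩
  have hcase : ∀ v ∈ U, (v ∈ K ∧ p v = g v) ∨ (v ∈ J ∧ p v = e v) ∨ (v ∈ U \ N ∧ p v = c v) := by
    intro v hv
    by_cases hvN : v ∈ N
    · by_cases hlow : degIn G U v = d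
      · have h1 : v ∈ K := mem_lows.2 ⟨hvN, hlow⟩
        exact Or.inl ⟨h1, by simp only [hp, h1, if_true]⟩
      · have h1 : v ∈ J := mem_highs.2 ⟨hvN, hlow⟩
        exact Or.inr (Or.inl ⟨h1, by simp only [hp, hJK v h1, h1, if_true, if_false]⟩)
    · have h1 : v ∉ K := fun hm => hvN (mem_lows.1 hm).1
      have h2 : v ∉ J := fun hm => hvN (mem_highs.1 hm).1
      exact Or.inr (Or.inr ⟨mem_sdiff.2 ⟨hv, hvN⟩, by simp only [hp, h1, h2, if_false]⟩)
  have hclosed : ∀ v ∈ K, ∀ x ∈ U \ N, ¬ G.Adj v x := fun v hv x hx hvx =>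
    (mem_sdiff.1 hx).2 (hN.closed hv (mem_sdiff.1 hx).1 hvx)
  have hgJ : ∀ v ∈ K, ∀ x ∈ J, g v ≠ e x := by
    intro v hv x hx hvx
    exact (mem_sdiff.1 (hg v hv)).2 (hvx ▸ mem_image_of_mem _ hx)
  refine h.not_col ⟨p, ?_, ?_⟩
  · intro v hv
    rcases hcase v hv with ⟨h1, h2⟩ | ⟨h1, h2⟩ | ⟨h1, h2⟩ <;> rw [h2]
    · exact mem_range.1 (mem_sdiff.1 (hg v h1)).1
    · exact (hej v h1).1
    · exact hc v h1
  · intro v hv x hx hvx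
    rcases hcase v hv with ⟨h1, h2⟩ | ⟨h1, h2⟩ | ⟨h1, h2⟩ <;>
      rcases hcase x hx with ⟨k1, k2⟩ | ⟨k1, k2⟩ | ⟨k1, k2⟩ <;> rw [h2, k2]
    · exact fun heq => hvx.ne (hginj h1 k1 heq)
    · exact hgJ v h1 x k1
    · exact absurd hvx (hclosed v h1 x k1)
    · exact (hgJ x k1 v h1).symm
    · exact absurd hvx (hN.not_adj_highs h h1 k1)
    · exact ((hej v h1).2 x k1 hvx).symm
    · exact absurd hvx.symm (hclosed x k1 v h1)
    · exact (hej x k1).2 v h1 hvx.symm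
    · exact hc' v h1 x k1 hvx

lemma Tight.col_sdiff (h : Tight d G U) (hsub : N ⊆ U) (hne : N.Nonempty) : Col G (U \ N) d := by
  obtain ⟨x, hx⟩ := hne
  refine (h.erase_col x (hsub hx)).subset fun v hv => ?_
  rw [mem_sdiff] at hv
  exact mem_erase.2 ⟨fun hvx => hv.2 (hvx ▸ hx), hv.1⟩

/-- A twin class of a tight set is a clique, or `d = 4` and it has exactly two vertices of degree
`5`. -/
lemma TwinClass.clique_or (hN : TwinClass d G U N) (h : Tight d G U)
    (hk : 3 ≤ (lows d G U N).card) :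
    (highs d G U N).card ≤ 1 ∨ d = 4 ∧ (highs d G U N).card = 2 := by
  by_contra hcon
  push Not at hcon
  obtain ⟨hj, hd⟩ := hcon
  have hKJ := hN.card_add
  set J := highs d G U N with hJ
  obtain ⟨c, hc, hc'⟩ := h.col_sdiff hN.sub (card_pos.1 (by rw [hN.card]; omega))
  set F : V → Finset ℕ := fun v => range d \ ((U \ N).filter (G.Adj v)).image c with hF
  have hFcard : ∀ v ∈ J, d - J.card ≤ (F v).card := by
    intro v hv
    have h1 := le_card_sdiff (((U \ N).filter (G.Adj v)).image c) (range d)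
    have h2 : (((U \ N).filter (G.Adj v)).image c).card ≤ J.card :=
      card_image_le.trans (hN.degIn_sdiff h hv).le
    rw [card_range] at h1
    simp only [hF]
    omega
  have hmemF : ∀ v m, m ∈ F v → m < d ∧ ∀ x ∈ U \ N, G.Adj v x → c x ≠ m := by
    intro v m hm
    rw [mem_sdiff, mem_range] at hm
    exact ⟨hm.1, fun x hx hvx hcx => hm.2 (mem_image.2 ⟨x, mem_filter.2 ⟨hx, hvx⟩, hcx⟩)⟩
  have hdisj : (J : Set V).PairwiseDisjoint F := by
    intro u hu w hw huw
    refine disjoint_left.2 fun m hmu hmw => ?_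
    exact hN.not_free h (by omega) hc hc' hu hw huw (hmemF u m hmu).1 (hmemF u m hmu).2
      (hmemF w m hmw).2
  have h1 : (J.biUnion F).card ≤ d := by
    have : J.biUnion F ⊆ range d := biUnion_subset.2 fun v _ => sdiff_subset
    simpa using card_le_card this
  rw [card_biUnion hdisj] at h1
  -- Disjoint lists of at least `d - |J|` free colours give `|J| (d - |J|) ≤ d`. With `e = d - |J|`
  -- this reads `(|J| - 1)(e - 1) ≤ 1`, while `|J|, e ≥ 2`.
  have h2 := card_nsmul_le_sum J (fun v => (F v).card) _ hFcard
  rw [smul_eq_mul] at h2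
  obtain ⟨e, he⟩ : ∃ e, d = J.card + e := ⟨d - J.card, by omega⟩
  have he' : d - J.card = e := by omega
  rw [he'] at h2
  have he2 : 2 ≤ e := by omega
  by_cases hj2 : J.card = 2
  · have : e ≤ 2 := by rw [hj2] at h2 he; omega
    exact hd (by omega) hj2
  · have : 3 ≤ J.card := by omega
    nlinarith

end

/-! ### Reduction to a smaller tight set and classification -/

section

variable {V : Type*} {G : SimpleGraph V} {d : ℕ} {U N : Finset V}

/-- The exceptional tight sets: nine vertices, two of which have degree `5`, and every vertex of
degree `4` is adjacent to a vertex of degree `5`. -/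
structure Exceptional (d : ℕ) (G : SimpleGraph V) (U : Finset V) : Prop where
  d_eq : d = 4
  card : U.card = 9
  card_high : (U.filter fun v => degIn G U v = d + 1).card = 2
  exists_high : ∀ v ∈ U, degIn G U v = d → ∃ a ∈ U, G.Adj v a ∧ degIn G U a = d + 1

/-- Add all edges between `u` and `B`. -/
def join (G : SimpleGraph V) (u : V) (B : Finset V) : SimpleGraph V :=
  G ⊔ SimpleGraph.fromRel fun a b => a = u ∧ b ∈ B

lemma join_adj {u : V} {B : Finset V} {a b : V} (ha : a ≠ u) (hb : b ≠ u) :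
    (join G u B).Adj a b ↔ G.Adj a b := by
  simp [join, ha, hb]

lemma join_adj_left {u : V} {B : Finset V} {b : V} (hb : b ≠ u) :
    (join G u B).Adj u b ↔ G.Adj u b ∨ b ∈ B := by
  simp [join, hb, hb.symm]

lemma TwinClass.eq_of_card_highs_le_one (hN : TwinClass d G U N) (h : Tight d G U)
    (hj : (highs d G U N).card ≤ 1) : U.card = d + 1 ∧ ∀ s ∈ U, ∀ t ∈ U, s ≠ t → G.Adj s t := by
  have hcl : ∀ s ∈ N, ∀ t ∈ N, s ≠ t → G.Adj s t := by
    intro s hs t ht hst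
    by_cases h1 : degIn G U t = d
    · exact hN.adj t ht h1 s hs hst
    · by_cases h2 : degIn G U s = d
      · exact (hN.adj s hs h2 t ht hst.symm).symm
      · exact absurd (card_le_one.1 hj s (mem_highs.2 ⟨hs, h2⟩) t (mem_highs.2 ⟨ht, h1⟩)) hst
  obtain rfl := h.eq_of_not_col hN.sub (not_col_of_clique hcl (by rw [hN.card]; omega))
  exact ⟨hN.card, hcl⟩

section

variable {u w : V}

/-- The neighbours of `u` in `U` outside `N`. -/
def outer (G : SimpleGraph V) (U N : Finset V) (u : V) : Finset V := (U \ N).filter (G.Adj u)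

lemma mem_outer {x : V} : x ∈ outer G U N u ↔ x ∈ U \ N ∧ G.Adj u x := mem_filter

/-- Every colouring of the rest uses all colours on the outer neighbours of two vertices of
degree `d + 1`. -/
lemma TwinClass.exists_outer (hN : TwinClass d G U N) (h : Tight d G U)
    (hk : 2 ≤ (lows d G U N).card) {c : V → ℕ} (hc : ∀ v ∈ U \ N, c v < d)
    (hc' : ∀ a ∈ U \ N, ∀ b ∈ U \ N, G.Adj a b → c a ≠ c b) (hu : u ∈ highs d G U N)
    (hw : w ∈ highs d G U N) (huw : u ≠ w) {a : ℕ} (ha : a < d) :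
    ∃ x ∈ outer G U N u ∪ outer G U N w, c x = a := by
  by_contra hno
  push Not at hno
  refine hN.not_free h hk hc hc' hu hw huw ha ?_ ?_
  · exact fun x hx hux => hno x (mem_union_left _ (mem_outer.2 ⟨hx, hux⟩))
  · exact fun x hx hwx => hno x (mem_union_right _ (mem_outer.2 ⟨hx, hwx⟩))

/-- Deleting `N` apart from `u` and joining `u` to the outer neighbours of `w` yields a smaller
tight set of the modified graph. -/
lemma TwinClass.exists_tight_join (hN : TwinClass d G U N) (h : Tight d G U)
    (hk : 2 ≤ (lows d G U N).card) (hu : u ∈ highs d G U N) (hw : w ∈ highs d G U N) (huw : u ≠ w)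
    (hcard : (outer G U N u ∪ outer G U N w).card ≤ d) :
    ∃ T ⊆ insert u (U \ N), u ∈ T ∧ Tight d (join G u (outer G U N w)) T ∧
      (∀ a ∈ T, a ≠ u → degIn (join G u (outer G U N w)) T a ≤ degIn G U a) ∧
      (∀ a ∈ T, (join G u (outer G U N w)).Adj u a → a ∈ outer G U N u ∪ outer G U N w) ∧
      degIn (join G u (outer G U N w)) T u ≤ d := by
  set B := outer G U N w with hB
  set G' := join G u B with hG'
  have huN := (mem_highs.1 hu).1
  have hwN := (mem_highs.1 hw).1
  have huS : u ∉ U \ N := fun hm => (mem_sdiff.1 hm).2 huN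
  have hSne : ∀ v ∈ U \ N, v ≠ u := fun v hv hvu => huS (hvu ▸ hv)
  -- The outer neighbours of `u` and `w` carry all `d` colours in any colouring of the rest, so none
  -- is left for `u`.
  have hnot : ¬ Col G' (insert u (U \ N)) d := by
    rintro ⟨c, h1, h2⟩
    obtain ⟨x, hx, hxc⟩ := hN.exists_outer h hk (c := c)
      (fun v hv => h1 v (mem_insert_of_mem hv))
      (fun a ha b hb hab => h2 a (mem_insert_of_mem ha) b (mem_insert_of_mem hb)
        ((join_adj (hSne a ha) (hSne b hb)).2 hab)) hu hw huw (h1 u (mem_insert_self _ _))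
    have hxS : x ∈ U \ N := by
      rcases mem_union.1 hx with hx | hx <;> exact (mem_outer.1 hx).1
    refine h2 u (mem_insert_self _ _) x (mem_insert_of_mem hxS) ?_ hxc.symm
    rw [hG', join_adj_left (hSne x hxS)]
    rcases mem_union.1 hx with hx | hx
    · exact Or.inl (mem_outer.1 hx).2
    · exact Or.inr hx
  obtain ⟨T, hT, hTnot, hTer⟩ := exists_critical_subset hnot
  have huT : u ∈ T := by
    by_contra huT
    have hTS : T ⊆ U \ N := fun v hv =>
      (mem_insert.1 (hT hv)).resolve_left fun hvu => huT (hvu ▸ hv)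
    obtain ⟨c, h1, h2⟩ := (h.col_sdiff hN.sub ⟨u, huN⟩).subset hTS
    exact hTnot ⟨c, h1, fun a ha b hb hab => h2 a ha b hb
      ((join_adj (hSne a (hTS ha)) (hSne b (hTS hb))).1 hab)⟩
  have hTS : ∀ a ∈ T, a ≠ u → a ∈ U \ N := fun a ha hau => (mem_insert.1 (hT ha)).resolve_left hau
  have hTU : T ⊆ U := hT.trans (insert_subset (hN.sub huN) sdiff_subset)
  -- A vertex of `B` may gain the neighbour `u`, but it loses `w`.
  have hdeg : ∀ a ∈ T, a ≠ u → degIn G' T a ≤ degIn G U a := by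
    intro a ha hau
    by_cases haB : a ∈ B
    · have haw : G.Adj a w := (mem_outer.1 haB).2.symm
      have hsub : T.filter (G'.Adj a) ⊆ insert u ((U.filter (G.Adj a)).erase w) := by
        intro b hb
        rw [mem_filter] at hb
        by_cases hbu : b = u
        · exact hbu ▸ mem_insert_self _ _
        · refine mem_insert_of_mem (mem_erase.2 ⟨?_, mem_filter.2 ⟨hTU hb.1, ?_⟩⟩)
          · exact fun hbw => (mem_sdiff.1 (hTS b hb.1 hbu)).2 (hbw ▸ hwN)
          · exact (join_adj hau hbu).1 hb.2
      have h1 := (card_le_card hsub).trans (card_insert_le _ _)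
      rwa [card_erase_add_one (mem_filter.2 ⟨hN.sub hwN, haw⟩)] at h1
    · refine card_le_card fun b hb => ?_
      rw [mem_filter] at hb
      refine mem_filter.2 ⟨hTU hb.1, ?_⟩
      by_cases hbu : b = u
      · subst hbu
        exact (((join_adj_left hau).1 hb.2.symm).resolve_right haB).symm
      · exact (join_adj hau hbu).1 hb.2
  have hnbr : ∀ a ∈ T, G'.Adj u a → a ∈ outer G U N u ∪ B := by
    intro a ha hua
    have hau : a ≠ u := hua.ne'
    rcases (join_adj_left hau).1 hua with h1 | h1
    · exact mem_union_left _ (mem_outer.2 ⟨hTS a ha hau, h1⟩)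
    · exact mem_union_right _ h1
  have hdegu : degIn G' T u ≤ d := by
    refine (card_le_card fun a ha => ?_).trans hcard
    rw [mem_filter] at ha
    exact hnbr a ha.1 ha.2
  refine ⟨T, hT, huT, ⟨hTnot, hTer, ?_, ?_⟩, hdeg, hnbr, hdegu⟩
  · intro v hv
    by_cases hvu : v = u
    · subst hvu; omega
    · exact (hdeg v hv hvu).trans (h.deg_le v (hTU hv))
  · intro a ha b hb hab hda hdb
    have hau : a ≠ u := by rintro rfl; omega
    have hbu : b ≠ u := by rintro rfl; omega
    have h1 := hdeg a ha hau
    have h2 := hdeg b hb hbu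
    have h3 := h.deg_le a (hTU ha)
    have h4 := h.deg_le b (hTU hb)
    exact h.indep a (hTU ha) b (hTU hb) ((join_adj hau hbu).1 hab) (by omega) (by omega)

lemma TwinClass.deg_outer (hN : TwinClass d G U N) (h : Tight d G U) (hu : u ∈ highs d G U N)
    (hw : w ∈ highs d G U N) {a : V} (ha : a ∈ outer G U N u ∪ outer G U N w) :
    degIn G U a ≠ d + 1 := by
  rw [mem_highs] at hu hw
  rcases mem_union.1 ha with ha | ha <;> rw [mem_outer, mem_sdiff] at ha
  · exact h.indep u (hN.sub hu.1) a ha.1.1 ha.2 (h.deg_eq (hN.sub hu.1) hu.2)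
  · exact h.indep w (hN.sub hw.1) a ha.1.1 ha.2 (h.deg_eq (hN.sub hw.1) hw.2)

/-- `N ∪ M` is already not 4-colourable, hence is all of `U`. If `u` and `w` differ in colour, the
five vertices of `N` need five colours; if they agree, the 4-clique `M` has a vertex of their
colour, and it is adjacent to one of them. -/
lemma TwinClass.exceptional (hN : TwinClass 4 G U N) (h : Tight 4 G U) (huw : u ≠ w)
    (hJ : highs 4 G U N = {u, w}) (hcard : (outer G U N u ∪ outer G U N w).card = 4)
    (hcl : ∀ s ∈ outer G U N u ∪ outer G U N w, ∀ t ∈ outer G U N u ∪ outer G U N w,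
      s ≠ t → G.Adj s t) : Exceptional 4 G U := by
  set M := outer G U N u ∪ outer G U N w with hM
  have hu : u ∈ highs 4 G U N := by simp [hJ]
  have hw : w ∈ highs 4 G U N := by simp [hJ]
  have huN := (mem_highs.1 hu).1
  have hwN := (mem_highs.1 hw).1
  have hMS : M ⊆ U \ N := union_subset (filter_subset _ _) (filter_subset _ _)
  have hadj : ∀ s ∈ N, ∀ t ∈ N, s ≠ t → s ∉ highs 4 G U N ∨ t ∉ highs 4 G U N → G.Adj s t := by
    intro s hs t ht hst hor
    by_cases h1 : degIn G U t = 4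
    · exact hN.adj t ht h1 s hs hst
    · by_cases h2 : degIn G U s = 4
      · exact (hN.adj s hs h2 t ht hst.symm).symm
      · rcases hor with hor | hor
        · exact absurd (mem_highs.2 ⟨hs, h2⟩) hor
        · exact absurd (mem_highs.2 ⟨ht, h1⟩) hor
  have hnot : ¬ Col G (N ∪ M) 4 := by
    rintro ⟨c, h1, h2⟩
    have hcuw : c u ≠ c w := by
      intro hcc
      have hinj : Set.InjOn c M := by
        intro s hs t ht hst
        by_contra hne
        exact h2 s (mem_union_right _ hs) t (mem_union_right _ ht) (hcl s hs t ht hne) hst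
      have himg : M.image c = range 4 := by
        refine eq_of_subset_of_card_le (fun m hm => ?_) ?_
        · obtain ⟨x, hx, rfl⟩ := mem_image.1 hm
          exact mem_range.2 (h1 x (mem_union_right _ hx))
        · rw [card_image_of_injOn hinj, hcard, card_range]
      have : c u ∈ M.image c := himg ▸ mem_range.2 (h1 u (mem_union_left _ huN))
      obtain ⟨x, hx, hxc⟩ := mem_image.1 this
      have hxZ := mem_union_right N hx
      rcases mem_union.1 hx with hx | hx
      · exact h2 u (mem_union_left _ huN) x hxZ (mem_outer.1 hx).2 hxc.symm
      · exact h2 w (mem_union_left _ hwN) x hxZ (mem_outer.1 hx).2 (hcc.symm.trans hxc.symm)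
    obtain ⟨s, hs, t, ht, hst, hc⟩ := exists_ne_map_eq_of_card_lt_of_maps_to
      (by rw [hN.card, card_range]; omega : (range 4).card < N.card)
      (fun v hv => mem_range.2 (h1 v (mem_union_left M hv)))
    by_cases hor : s ∉ highs 4 G U N ∨ t ∉ highs 4 G U N
    · exact h2 s (mem_union_left _ hs) t (mem_union_left _ ht) (hadj s hs t ht hst hor) hc
    · push Not at hor
      simp only [hJ, mem_insert, mem_singleton] at hor
      rcases hor with ⟨rfl | rfl, rfl | rfl⟩
      · exact hst rfl
      · exact hcuw hc
      · exact hcuw hc.symm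
      · exact hst rfl
  have hU := h.eq_of_not_col (union_subset hN.sub (hMS.trans sdiff_subset)) hnot
  have hdisj : Disjoint N M := disjoint_sdiff.mono_right hMS
  refine ⟨rfl, ?_, ?_, ?_⟩
  · rw [← hU, card_union_of_disjoint hdisj, hN.card, hcard]
  · have : (U.filter fun v => degIn G U v = 4 + 1) = highs 4 G U N := by
      ext v
      rw [mem_filter, mem_highs]
      constructor
      · rintro ⟨hv, hdv⟩
        refine ⟨?_, by omega⟩
        rw [← hU] at hv
        exact (mem_union.1 hv).resolve_right fun hvM => hN.deg_outer h hu hw hvM hdv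
      · rintro ⟨hv, hdv⟩
        exact ⟨hN.sub hv, h.deg_eq (hN.sub hv) hdv⟩
    rw [this, hJ, card_pair huw]
  · have hdu := h.deg_eq (hN.sub huN) (mem_highs.1 hu).2
    have hdw := h.deg_eq (hN.sub hwN) (mem_highs.1 hw).2
    intro v hv hdv
    rw [← hU] at hv
    rcases mem_union.1 hv with hv | hv
    · refine ⟨u, hN.sub huN, ?_, hdu⟩
      exact (hN.adj v hv hdv u huN fun huv => (mem_highs.1 hu).2 (huv ▸ hdv)).symm
    · rcases mem_union.1 hv with hv | hv
      · exact ⟨u, hN.sub huN, (mem_outer.1 hv).2.symm, hdu⟩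
      · exact ⟨w, hN.sub hwN, (mem_outer.1 hv).2.symm, hdw⟩

end

/-- **Classification** of tight sets: complete graphs and the exceptional sets. -/
theorem Tight.classification [Finite V] (hd : 4 ≤ d) (h : Tight d G U) :
    (U.card = d + 1 ∧ ∀ s ∈ U, ∀ t ∈ U, s ≠ t → G.Adj s t) ∨ Exceptional d G U := by
  induction hm : U.card using Nat.strong_induction_on generalizing G U with
  | _ m ih =>
    obtain ⟨N, hNU, hNc, hk, hadj⟩ := h.exists_twin_class hd
    have hN : TwinClass d G U N := ⟨hNU, hNc, hadj⟩
    rcases hN.clique_or h hk with hj | ⟨rfl, hj⟩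
    · left
      rw [← hm]
      exact hN.eq_of_card_highs_le_one h hj
    · right
      obtain ⟨u, w, huw, hJ⟩ := card_eq_two.1 hj
      have hu : u ∈ highs 4 G U N := by simp [hJ]
      have hw : w ∈ highs 4 G U N := by simp [hJ]
      have hcu : (outer G U N u).card = 2 := (hN.degIn_sdiff h hu).trans hj
      have hcw : (outer G U N w).card = 2 := (hN.degIn_sdiff h hw).trans hj
      have hcard : (outer G U N u ∪ outer G U N w).card ≤ 4 :=
        (card_union_le _ _).trans (by omega)
      obtain ⟨T, hT, huT, hTight, hdeg, hnbr, hdegu⟩ :=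
        hN.exists_tight_join h (by change 3 ≤ (lows 4 G U N).card at hk; omega) hu hw huw hcard
      have hlt : T.card < m := by
        have h1 := (card_le_card hT).trans (card_insert_le _ _)
        have h2 := card_sdiff_add_card_eq_card hNU
        omega
      rcases ih T.card hlt hTight rfl with ⟨hTc, hTcl⟩ | hex
      -- In the complete case, the other four vertices of `T` are exactly the outer neighbours of
      -- `u` and `w`.
      · have hsub : T.erase u ⊆ outer G U N u ∪ outer G U N w := fun a ha =>
          hnbr a (mem_of_mem_erase ha) (hTcl u huT a (mem_of_mem_erase ha) (mem_erase.1 ha).1.symm)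
        have hTe : (T.erase u).card = 4 := by rw [card_erase_of_mem huT, hTc]
        have heq := eq_of_subset_of_card_le hsub (by omega)
        refine hN.exceptional h huw hJ (by rw [← heq, hTe]) ?_
        rw [← heq]
        intro s hs t ht hst
        rw [mem_erase] at hs ht
        exact (join_adj hs.1 ht.1).1 (hTcl s hs.2 t ht.2 hst)
      -- In the exceptional case the low vertex `u` has a high neighbour, which is then high in `U`
      -- as well; but outer neighbours of high vertices are low.
      · obtain ⟨a, ha, hua, hda⟩ := hex.exists_high u huT (le_antisymm hdegu (hTight.le_deg huT))
        have h1 := hdeg a ha hua.ne'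
        have haM := hnbr a ha hua
        have haU : a ∈ U := by
          rcases mem_union.1 haM with h2 | h2 <;> exact (mem_sdiff.1 (mem_outer.1 h2).1).1
        have h2 := h.deg_le a haU
        exact absurd (by omega) (hN.deg_outer h hu hw haM)

/-- A critical graph as in the main theorem yields a tight vertex set. -/
lemma tight_of_isCritical [Fintype V] [DecidableRel G.Adj] (hcrit : G.IsCritical (d + 1))
    (hmax : G.maxDegree ≤ d + 1) (hindep : G.IsIndepSet {v : V | G.degree v = d + 1}) :
    Tight d G univ := by
  have hdeg : ∀ v, degIn G univ v = G.degree v := by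
    intro v
    rw [← G.card_neighborFinset_eq_degree, G.neighborFinset_eq_filter]
    unfold degIn
    congr
  refine ⟨?_, ?_, ?_, ?_⟩
  · rintro ⟨c, h1, h2⟩
    refine hcrit.not_colorable ⟨SimpleGraph.Coloring.mk (fun v => ⟨c v, h1 v (mem_univ v)⟩) ?_⟩
    intro v w hvw heq
    exact h2 v (mem_univ _) w (mem_univ _) hvw (congrArg Fin.val heq)
  · intro v _
    have hne : (⊤ : G.Subgraph).deleteVerts {v} ≠ ⊤ := by
      intro heq
      have : v ∈ ((⊤ : G.Subgraph).deleteVerts {v}).verts := by rw [heq]; trivial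
      simp at this
    obtain ⟨c⟩ := hcrit.colorable_of_ne_top _ hne
    have hmem : ∀ w, w ∈ univ.erase v → w ∈ ((⊤ : G.Subgraph).deleteVerts {v}).verts := by
      intro w hw
      simpa using (mem_erase.1 hw).1
    refine ⟨fun w => if hw : w ∈ univ.erase v then (c ⟨w, hmem w hw⟩ : ℕ) else 0, ?_, ?_⟩
    · intro w hw
      simp only [hw, dif_pos]
      exact (c ⟨w, hmem w hw⟩).2
    · intro a ha b hb hab
      simp only [ha, hb, dif_pos]
      intro heq
      refine c.valid (v := ⟨a, hmem a ha⟩) (w := ⟨b, hmem b hb⟩) ?_ (Fin.ext heq)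
      have ha' := (mem_erase.1 ha).1
      have hb' := (mem_erase.1 hb).1
      simp [ha', hb', hab]
  · intro v _
    rw [hdeg]
    exact (G.degree_le_maxDegree v).trans hmax
  · intro a _ b _ hab ha hb
    rw [hdeg] at ha hb
    exact hindep (x := a) ha (y := b) hb hab.ne hab

end

end

end HighIndep


theorem lemma6p3 {V : Type*} [Fintype V] (G : SimpleGraph V) [DecidableRel G.Adj]
    (d : ℕ) (hd : 4 ≤ d)
    (hcrit : G.IsCritical (d + 1))
    (hmax : G.maxDegree ≤ d + 1)
    (hindep : G.IsIndepSet {v : V | G.degree v = d + 1})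
    (n h : ℕ) (hn : Fintype.card V = n)
    (hh : (Finset.univ.filter fun v : V => G.degree v = d + 1).card = h)
    (hpos : 0 < h) :
    ⌈(((d : ℚ) - 2) * (n : ℚ) - ((d : ℚ) + 1) * ((d : ℚ) - 2)) / (d : ℚ)⌉ ≤ (h : ℤ) ∧
      (h : ℤ) ≤ ⌊((n : ℚ) - 3) / ((d : ℚ) - 1)⌋ := by
  have hT := HighIndep.tight_of_isCritical hcrit hmax hindep
  have hdeg : ∀ v, HighIndep.degIn G Finset.univ v = G.degree v := by
    intro v
    rw [← G.card_neighborFinset_eq_degree, G.neighborFinset_eq_filter]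
    unfold HighIndep.degIn
    congr
  rcases hT.classification hd with ⟨hc, -⟩ | hex
  -- With only `d + 1` vertices there is no room for degree `d + 1`.
  · obtain ⟨v, hv⟩ := Finset.card_pos.1 (hh ▸ hpos)
    have h1 := (Finset.mem_filter.1 hv).2
    have h2 := G.degree_lt_card_verts v
    rw [Finset.card_univ] at hc
    omega
  · obtain rfl := hex.d_eq
    have hn9 : n = 9 := by rw [← hn, ← Finset.card_univ]; exact hex.card
    have hh2 : h = 2 := by
      rw [← hh, ← hex.card_high]
      congr 1
      ext v
      simp [hdeg]
    subst hn9 hh2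
    -- For `d = 4`, `n = 9`, `h = 2` the fractions are `8 / 4` and `6 / 3`, so both bounds are
    -- attained.
    constructor
    · rw [Int.ceil_le]; norm_num
    · rw [Int.le_floor]; norm_num
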